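/- Let $p>3$ be a prime, let $B_0,B_1,B_2,\ldots$ be the Bernoulli numbers, and let $q_p(2)=(2^{p-1}-1)/p$ be the Fermat quotient. For rational numbers $a,b$ and a positive integer $m$, write $a\equiv b\pmod{p^m}$ if $a-b=p^m c$ for some rational number $c$ whose reduced denominator is not divisible by $p$. Then $$\frac1{p^2}\sum_{k=(p+1)/2}^{p-1}\frac{\binom{2k}k^2}{(2k+1)16^k}\equiv-\sum_{k=0}^{(p-3)/2}\frac{16^k}{(2k+1)^3\binom{2k}k^2}\equiv-\frac 74B_{p-3}\pmod p$$ and $$\sum_{k=0}^{(p-3)/2}\frac{\binom{2k}k^2}{(2k+1)16^k}\equiv-2q_p(2)-p\,q_p(2)^2+\frac 5{12}p^2B_{p-3}\pmod{p^3}.$$ -/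

import Mathlib

/-- Congruence of rational numbers modulo `p ^ m`: `a ≡ b (mod p ^ m)` means `a - b = p ^ m * c`
for a rational number `c` that is `p`-integral, i.e. whose reduced denominator is prime to `p`. -/
def RatModEq (p m : ℕ) (a b : ℚ) : Prop :=
  ∃ c : ℚ, ¬ p ∣ c.den ∧ a - b = (p : ℚ) ^ m * c

/-- The Fermat quotient `q_p(a) = (a ^ (p - 1) - 1) / p`, as a rational number. -/
def fermatQuotient (p a : ℕ) : ℚ :=
  ((a : ℚ) ^ (p - 1) - 1) / (p : ℚ)

open Finset

/-! ### Terminating hypergeometric sums, valid over ℚ and modulo p alike. -/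

section FieldIdentities

variable {K : Type*} [Field K]

/-! Write p = 2n + 1, c_k = (C(2k,k)/4^k)² (`centralTerm`) and H_r(m) = ∑_{j ≤ m} 1/j^r. The key
identity (`sum_prod_odd_sq_sub`) is ∑_{k ≤ m} (1/(2k+1)) ∏_{j<k} ((2j+1)² - (2m+1)²)/(2j+2)² =
1/(2m+1), used both exactly over ℚ and as Newton interpolation at the nodes (2m+1)² modulo p.

Congruence modulo p³. Over ℚ take m = n, so that 2m + 1 = p. The term k = n is (-1)^n C(2n,n)/p, and
each other term is c_k/(2k+1) times 1 - p² ∑_{j<k} 1/(2j+1)² + O(p⁴) (`sum_centralTerm_modEq`). An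
exact product for (-1)^n C(2n,n) gives (1 + p q_p(2))² (1 - p³V/12 + O(p⁴)) with V ≡ H_3(n)/2
(`centralBinom_modEq`). The p² coefficient is therefore a multiple of H_3(n) modulo p.

Congruences modulo p. The reflection k ↦ p-1-k carries the tail sum to the inverse sum, because
C(2k,k)/p and (2j+1)C(2j,j) multiply to -1 when k = p-1-j (`centralBinom_reflect`). The reflection k
↦ n-1-k then reduces the inverse sum to ∑ 1/((k+1)³ c_{k+1}).

Two such sums are coefficients of polynomials F of degree < n whose values at squares are known.
Since power sums over the nonzero residues vanish unless the exponent is divisible by p-1, summing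
F(x²) or F(x²)/x² isolates the constant or the linear coefficient (`sum_eval_sq`,
`sum_eval_sq_div_sq`). What remains is H_3(n) and D(m) = ∑_{j<s≤m} 1/(js²).

Evaluating D(p-1) by pairing s with p-s, and again by splitting s by parity, gives two linear
relations that express D(n) and D(p-1) through H_3(n). Faulhaber's formula gives D(p-1) ≡ B_{p-3},
hence H_3(n) ≡ -2B_{p-3}. -/

theorem natCast_two_mul_add_one_ne_zero {N : ℕ} (hN : ∀ j : ℕ, 0 < j → j < N → (j : K) ≠ 0)
    {m : ℕ} (hm : 2 * m + 1 < N) : (2 * m + 1 : K) ≠ 0 := by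
  have := hN (2 * m + 1) (by omega) hm
  push_cast at this
  exact this

theorem natCast_add_one_ne_zero {N : ℕ} (hN : ∀ j : ℕ, 0 < j → j < N → (j : K) ≠ 0)
    {m : ℕ} (hm : m + 1 < N) : (m + 1 : K) ≠ 0 := by
  have := hN (m + 1) (by omega) hm
  push_cast at this
  exact this

/-- The `k`-th coefficient of the `m`-th shifted Legendre polynomial. -/
def legendreTerm (K : Type*) [Field K] (m k : ℕ) : K :=
  ∏ j ∈ range k, ((j : K) - m) * (j + m + 1) / (j + 1) ^ 2

theorem legendreTerm_succ (m k : ℕ) :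
    legendreTerm K m (k + 1) =
      legendreTerm K m k * (((k : K) - m) * (k + m + 1) / (k + 1) ^ 2) :=
  prod_range_succ _ _

theorem legendreTerm_eq_zero {m k : ℕ} (h : m < k) : legendreTerm K m k = 0 :=
  prod_eq_zero (mem_range.2 h) (by simp)

/-- The product `(-m)_k (m+2)_k / k!²`. -/
def legendreAux (K : Type*) [Field K] (m k : ℕ) : K :=
  ∏ j ∈ range k, ((j : K) - m) * (j + m + 2) / (j + 1) ^ 2

theorem legendreAux_succ (m k : ℕ) :
    legendreAux K m (k + 1) =
      legendreAux K m k * (((k : K) - m) * (k + m + 2) / (k + 1) ^ 2) :=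
  prod_range_succ _ _

theorem legendreAux_eq_zero {m k : ℕ} (h : m < k) : legendreAux K m k = 0 :=
  prod_eq_zero (mem_range.2 h) (by simp)

theorem legendreTerm_succ_succ {N : ℕ} (hN : ∀ j : ℕ, 0 < j → j < N → (j : K) ≠ 0) (m k : ℕ)
    (hk : k + 1 < N) :
    legendreTerm K (m + 1) (k + 1) =
      -(m + 1) * (k + m + 2) * legendreAux K m k / (k + 1) ^ 2 := by
  induction k with
  | zero => simp only [legendreTerm, legendreAux, range_one, prod_singleton, range_zero,
      prod_empty, zero_add]; push_cast; ring
  | succ k ih =>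
    rw [legendreTerm_succ, ih (by omega), legendreAux_succ]
    have h1 := natCast_add_one_ne_zero hN (show k + 1 < N by omega)
    have h2 := natCast_add_one_ne_zero hN hk
    push_cast at h2 ⊢
    field_simp
    ring

theorem legendreTerm_eq_legendreAux {N : ℕ} (hN : ∀ j : ℕ, 0 < j → j < N → (j : K) ≠ 0) (m k : ℕ)
    (hk : k + 1 < N) :
    legendreTerm K m (k + 1) = (m + 1) * (k - m) * legendreAux K m k / (k + 1) ^ 2 := by
  induction k with
  | zero => simp only [legendreTerm, legendreAux, range_one, prod_singleton, range_zero,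
      prod_empty, zero_add]; push_cast; ring
  | succ k ih =>
    rw [legendreTerm_succ, ih (by omega), legendreAux_succ]
    have h1 := natCast_add_one_ne_zero hN (show k + 1 < N by omega)
    have h2 := natCast_add_one_ne_zero hN hk
    push_cast at h2 ⊢
    field_simp
    ring

/-- Telescoping: (k-m)(k+m+2) = (k+1)² - (m+1)². At k = m + 1 the right side is 1. -/
theorem sum_legendreAux {N : ℕ} (hN : ∀ j : ℕ, 0 < j → j < N → (j : K) ≠ 0) (m k : ℕ)
    (hk : k < N) :
    (m + 1) ^ 2 * ∑ i ∈ range k, legendreAux K m i / (i + 1) ^ 2 = 1 - legendreAux K m k := by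
  induction k with
  | zero => simp [legendreAux]
  | succ k ih =>
    rw [sum_range_succ, mul_add, ih (by omega), legendreAux_succ]
    have h1 := natCast_add_one_ne_zero hN (show k + 1 < N by omega)
    field_simp
    ring

/-- Over ℝ this is ∫₀¹ P_m(1 - 2x²) dx = 1/(2m+1). The induction on m uses that the coefficients for
m and m+1 are both rational multiples of `legendreAux`, so that the difference of consecutive
summands telescopes. -/
theorem sum_legendreTerm_div {N : ℕ} (hN : ∀ j : ℕ, 0 < j → j < N → (j : K) ≠ 0) (m : ℕ)
    (hm : 2 * m + 1 < N) :
    (2 * m + 1) * ∑ k ∈ range (m + 1), legendreTerm K m k / (2 * k + 1) = 1 := by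
  induction m with
  | zero => simp [legendreTerm]
  | succ m ih =>
    have key : ∀ k ∈ range (m + 1),
        (2 * (m + 1) + 1) * (legendreTerm K (m + 1) (k + 1) / (2 * (k + 1) + 1)) =
          (2 * m + 1) * (legendreTerm K m (k + 1) / (2 * (k + 1) + 1)) -
            2 * ((m + 1) ^ 2 * (legendreAux K m k / (k + 1) ^ 2)) := by
      intro k hk
      rw [mem_range] at hk
      rw [legendreTerm_succ_succ hN m k (by omega), legendreTerm_eq_legendreAux hN m k (by omega)]
      have h1 := natCast_add_one_ne_zero hN (show k + 1 < N by omega)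
      have h2 := natCast_two_mul_add_one_ne_zero hN (show 2 * (k + 1) + 1 < N by omega)
      push_cast at h2
      field_simp
      ring
    have h3 := ih (by omega)
    have h4 := sum_legendreAux hN m (m + 1) (by omega)
    rw [legendreAux_eq_zero (Nat.lt_succ_self m)] at h4
    have h5 : ∑ k ∈ range (m + 1), legendreTerm K m (k + 1) / (2 * (k + 1) + 1) + 1 =
        ∑ k ∈ range (m + 1), legendreTerm K m k / (2 * k + 1) := by
      have e := sum_range_succ' (fun k : ℕ => legendreTerm K m k / (2 * (k : K) + 1)) (m + 1)
      rw [sum_range_succ, legendreTerm_eq_zero (Nat.lt_succ_self m)] at e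
      simp only [zero_div, add_zero, Nat.cast_zero, mul_zero, zero_add, div_one] at e
      rw [e]
      push_cast
      simp [legendreTerm]
    rw [sum_range_succ', mul_add]
    push_cast
    rw [mul_sum, sum_congr rfl key, sum_sub_distrib, ← mul_sum, ← mul_sum, ← mul_sum, h4]
    have h6 : legendreTerm K (m + 1) 0 = 1 := by simp [legendreTerm]
    rw [h6]
    linear_combination h3 + (2 * m + 1) * h5

/-- Evaluation of a Saalschützian `₃F₂` at the nodes `(2m+1)²`. -/
theorem sum_prod_odd_sq_sub {N : ℕ} (hN : ∀ j : ℕ, 0 < j → j < N → (j : K) ≠ 0) (h2 : (2 : K) ≠ 0)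
    (m : ℕ) (hm : 2 * m + 1 < N) :
    ∑ k ∈ range (m + 1),
      (∏ j ∈ range k, ((2 * (j : K) + 1) ^ 2 - (2 * m + 1) ^ 2) / (2 * j + 2) ^ 2) / (2 * (k : K) + 1) =
      1 / (2 * (m : K) + 1) := by
  rw [eq_div_iff (natCast_two_mul_add_one_ne_zero hN hm), mul_comm]
  refine Eq.trans ?_ (sum_legendreTerm_div hN m hm)
  refine congrArg _ (sum_congr rfl fun k hk => congrArg (· / (2 * (k : K) + 1)) ?_)
  refine prod_congr rfl fun j hj => ?_
  rw [mem_range] at hk hj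
  have h1 := natCast_add_one_ne_zero hN (show j + 1 < N by omega)
  have h3 : (2 * j + 2 : K) ≠ 0 := by
    rw [show (2 * j + 2 : K) = 2 * (j + 1) by ring]
    exact mul_ne_zero h2 h1
  rw [div_eq_div_iff (pow_ne_zero _ h3) (pow_ne_zero _ h1)]
  ring

/-- The product `(-m)_k (m)_k / (1/2)_k²`. -/
def halfTerm (K : Type*) [Field K] (m k : ℕ) : K :=
  ∏ j ∈ range k, 4 * (((j : K) - m) * (j + m)) / (2 * j + 1) ^ 2

theorem halfTerm_succ (m k : ℕ) :
    halfTerm K m (k + 1) =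
      halfTerm K m k * (4 * (((k : K) - m) * (k + m)) / (2 * k + 1) ^ 2) :=
  prod_range_succ _ _

theorem halfTerm_eq_zero {m k : ℕ} (h : m < k) : halfTerm K m k = 0 :=
  prod_eq_zero (mem_range.2 h) (by simp)

/-- The product `(-m)_k (m+1)_k / (1/2)_k²`. -/
def halfAux (K : Type*) [Field K] (m k : ℕ) : K :=
  ∏ j ∈ range k, 4 * (((j : K) - m) * (j + m + 1)) / (2 * j + 1) ^ 2

theorem halfAux_succ (m k : ℕ) :
    halfAux K m (k + 1) =
      halfAux K m k * (4 * (((k : K) - m) * (k + m + 1)) / (2 * k + 1) ^ 2) :=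
  prod_range_succ _ _

theorem halfAux_eq_zero {m k : ℕ} (h : m < k) : halfAux K m k = 0 :=
  prod_eq_zero (mem_range.2 h) (by simp)

theorem halfTerm_succ_succ {N : ℕ} (hN : ∀ j : ℕ, 0 < j → j < N → (j : K) ≠ 0) (m k : ℕ)
    (hk : 2 * k + 1 < N) :
    halfTerm K (m + 1) (k + 1) =
      -4 * (m + 1) * (k + m + 1) * halfAux K m k / (2 * k + 1) ^ 2 := by
  induction k with
  | zero => simp [halfTerm, halfAux]; ring
  | succ k ih =>
    rw [halfTerm_succ, ih (by omega), halfAux_succ]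
    have h1 := natCast_two_mul_add_one_ne_zero hN (show 2 * k + 1 < N by omega)
    have h2 := natCast_two_mul_add_one_ne_zero hN hk
    push_cast at h2 ⊢
    field_simp
    ring

theorem halfTerm_eq_halfAux {N : ℕ} (hN : ∀ j : ℕ, 0 < j → j < N → (j : K) ≠ 0) (m k : ℕ)
    (hk : 2 * k + 1 < N) :
    halfTerm K m (k + 1) = 4 * m * (k - m) * halfAux K m k / (2 * k + 1) ^ 2 := by
  induction k with
  | zero => simp [halfTerm, halfAux]; ring
  | succ k ih =>
    rw [halfTerm_succ, ih (by omega), halfAux_succ]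
    have h1 := natCast_two_mul_add_one_ne_zero hN (show 2 * k + 1 < N by omega)
    have h2 := natCast_two_mul_add_one_ne_zero hN hk
    push_cast at h2 ⊢
    field_simp
    ring

/-- Telescoping: 4(k-m)(k+m+1) = (2k+1)² - (2m+1)². Only the denominators 2i+1 with i < k occur,
whence the bound 2k - 1 < N. -/
theorem sum_halfAux {N : ℕ} (hN : ∀ j : ℕ, 0 < j → j < N → (j : K) ≠ 0) (m k : ℕ)
    (hk : 2 * k < N + 1) :
    (2 * m + 1) ^ 2 * ∑ i ∈ range k, halfAux K m i / (2 * i + 1) ^ 2 = 1 - halfAux K m k := by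
  induction k with
  | zero => simp [halfAux]
  | succ k ih =>
    rw [sum_range_succ, mul_add, ih (by omega), halfAux_succ]
    have h1 := natCast_two_mul_add_one_ne_zero hN (show 2 * k + 1 < N by omega)
    field_simp
    ring

/-- Same mechanism as `sum_legendreTerm_div`: passing from m to m+1 changes the sum by a telescoping
one, worth -4/(2m+1). -/
theorem sum_halfTerm_div {N : ℕ} (hN : ∀ j : ℕ, 0 < j → j < N → (j : K) ≠ 0) (m : ℕ)
    (hm : 2 * m < N) :
    ∑ k ∈ range m, halfTerm K m (k + 1) / (k + 1) =
      -4 * ∑ j ∈ range m, 1 / (2 * (j : K) + 1) := by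
  induction m with
  | zero => simp
  | succ m ih =>
    have key : ∀ k ∈ range (m + 1), halfTerm K (m + 1) (k + 1) / (k + 1) =
          halfTerm K m (k + 1) / (k + 1) -
            4 * (2 * m + 1) * (halfAux K m k / (2 * k + 1) ^ 2) := by
      intro k hk
      rw [mem_range] at hk
      rw [halfTerm_succ_succ hN m k (by omega), halfTerm_eq_halfAux hN m k (by omega)]
      have h1 := natCast_add_one_ne_zero hN (show k + 1 < N by omega)
      have h2 := natCast_two_mul_add_one_ne_zero hN (show 2 * k + 1 < N by omega)
      field_simp
      ring
    have h4 := sum_halfAux hN m (m + 1) (by omega)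
    rw [halfAux_eq_zero (Nat.lt_succ_self m)] at h4
    have h5 := natCast_two_mul_add_one_ne_zero hN (show 2 * m + 1 < N by omega)
    have h6 : ∑ i ∈ range (m + 1), halfAux K m i / (2 * (i : K) + 1) ^ 2 =
        1 / (2 * (m : K) + 1) ^ 2 := by
      rw [eq_div_iff (pow_ne_zero _ h5)]
      linear_combination h4
    rw [sum_congr rfl key, sum_sub_distrib, ← mul_sum, h6, sum_range_succ, sum_range_succ,
      ih (by omega), halfTerm_eq_zero (Nat.lt_succ_self m)]
    field_simp
    ring

end FieldIdentities

/-! ### Splitting a sum of even length by reflection or by parity. -/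

section Sums

variable {M : Type*} [AddCommMonoid M]

theorem sum_range_two_mul_reflect (f : ℕ → M) (n : ℕ) :
    ∑ i ∈ range (2 * n), f i = ∑ i ∈ range n, f i + ∑ i ∈ range n, f (2 * n - 1 - i) := by
  rw [two_mul, sum_range_add, ← sum_range_reflect (fun i => f (n + i))]
  congr 1
  refine sum_congr rfl fun i hi => ?_
  rw [mem_range] at hi
  congr 1
  omega

theorem sum_range_two_mul_parity (f : ℕ → M) (n : ℕ) :
    ∑ i ∈ range (2 * n), f i = ∑ i ∈ range n, f (2 * i) + ∑ i ∈ range n, f (2 * i + 1) := by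
  induction n with
  | zero => simp
  | succ n ih =>
    rw [show 2 * (n + 1) = 2 * n + 1 + 1 by ring, sum_range_succ, sum_range_succ, ih,
      sum_range_succ, sum_range_succ]
    abel

end Sums

/-! ### Power sums and symmetric sums over the nonzero residues. -/

section ModPrime

variable {p : ℕ} [hp : Fact p.Prime]

theorem zmod_natCast_ne_zero (j : ℕ) (h0 : 0 < j) (hj : j < p) : (j : ZMod p) ≠ 0 := by
  rw [Ne, ZMod.natCast_eq_zero_iff]
  exact Nat.not_dvd_of_pos_of_lt h0 hj

theorem zmod_two_ne_zero (h2 : 2 < p) : (2 : ZMod p) ≠ 0 := by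
  exact_mod_cast zmod_natCast_ne_zero 2 two_pos h2

theorem zmod_two_mul_add_one {n : ℕ} (hpn : p = 2 * n + 1) : (2 * n + 1 : ZMod p) = 0 := by
  have h : ((2 * n + 1 : ℕ) : ZMod p) = 0 := (ZMod.natCast_eq_zero_iff _ _).2 (by rw [hpn])
  exact_mod_cast h

theorem zmod_natCast_add_one_ne_zero {i : ℕ} (hi : i < p - 1) : (i + 1 : ZMod p) ≠ 0 := by
  exact_mod_cast zmod_natCast_ne_zero (i + 1) (by omega) (by omega)

theorem sum_zmod_eq_sum_range (f : ZMod p → ZMod p) :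
    ∑ x, f x = f 0 + ∑ i ∈ range (p - 1), f (i + 1) := by
  have h : ∑ x : ZMod p, f x = ∑ i ∈ range p, f i := by
    refine sum_nbij' (fun x => x.val) (fun i => (i : ZMod p)) ?_ ?_ ?_ ?_ ?_
    · intro x _
      exact mem_range.2 x.val_lt
    · simp
    · intro x _
      simp
    · intro i hi
      exact ZMod.val_cast_of_lt (mem_range.1 hi)
    · intro x _
      simp
  have e : p = p - 1 + 1 := by have := hp.out.pos; omega
  have h2 : ∑ i ∈ range p, f i = ∑ i ∈ range (p - 1 + 1), f i := by rw [← e]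
  rw [h, h2, sum_range_succ', add_comm]
  simp

theorem sum_range_pow_zmod {e : ℕ} (h0 : e ≠ 0) (he : e < p - 1) :
    ∑ i ∈ range (p - 1), (i + 1 : ZMod p) ^ e = 0 := by
  have h := FiniteField.sum_pow_lt_card_sub_one (ZMod p) e (by rwa [ZMod.card])
  rw [sum_zmod_eq_sum_range (fun x => x ^ e), zero_pow h0, zero_add] at h
  exact h

theorem sum_range_one_zmod : ∑ _i ∈ range (p - 1), (1 : ZMod p) = -1 := by
  rw [sum_const, card_range, nsmul_eq_mul, mul_one, Nat.cast_sub hp.out.one_le]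
  simp

theorem zmod_inv_pow {x : ZMod p} (hx : x ≠ 0) {e : ℕ} (he : e ≤ p - 1) :
    1 / x ^ e = x ^ (p - 1 - e) := by
  rw [div_eq_iff (pow_ne_zero _ hx), ← pow_add, Nat.sub_add_cancel he, ZMod.pow_card_sub_one_eq_one hx]

theorem sum_range_inv_pow_zmod {e : ℕ} (h0 : e ≠ 0) (he : e < p - 1) :
    ∑ i ∈ range (p - 1), 1 / (i + 1 : ZMod p) ^ e = 0 := by
  rw [← sum_range_pow_zmod (p := p) (e := p - 1 - e) (by omega) (by omega)]
  refine sum_congr rfl fun i hi => zmod_inv_pow ?_ he.le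
  exact zmod_natCast_add_one_ne_zero (mem_range.1 hi)

open Polynomial in
-- With degree < n every exponent 2j is below p-1, so only j = 0 contributes, with power sum p - 1 =
-- -1.
theorem sum_eval_sq (P : (ZMod p)[X]) {n : ℕ} (hpn : p = 2 * n + 1) (hP : P.natDegree < n) :
    ∑ i ∈ range (2 * n), P.eval ((i + 1 : ZMod p) ^ 2) = -P.coeff 0 := by
  have e : 2 * n = p - 1 := by omega
  simp_rw [eval_eq_sum_range' hP]
  rw [sum_comm]
  simp_rw [← mul_sum, ← pow_mul]
  rw [sum_eq_single_of_mem 0 (mem_range.2 (by omega))]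
  · simp only [mul_zero, pow_zero, e, sum_range_one_zmod]
    ring
  · intro j hj hj0
    rw [mem_range] at hj
    rw [e, sum_range_pow_zmod (by omega) (by omega), mul_zero]

open Polynomial in
-- The exponents 2j-2 lie between -2 and p-4; only j = 1 gives exponent 0.
theorem sum_eval_sq_div_sq (P : (ZMod p)[X]) {n : ℕ} (hpn : p = 2 * n + 1) (hn : 1 < n)
    (hP : P.natDegree < n) :
    ∑ i ∈ range (2 * n), P.eval ((i + 1 : ZMod p) ^ 2) / (i + 1 : ZMod p) ^ 2 = -P.coeff 1 := by
  have e : 2 * n = p - 1 := by omega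
  simp_rw [eval_eq_sum_range' hP, sum_div]
  rw [sum_comm]
  simp_rw [mul_div_assoc, ← mul_sum, ← pow_mul]
  rw [sum_eq_single_of_mem 1 (mem_range.2 (by omega))]
  · have h : ∀ i ∈ range (2 * n), (i + 1 : ZMod p) ^ (2 * 1) / (i + 1 : ZMod p) ^ 2 = 1 := by
      intro i hi
      rw [e, mem_range] at hi
      exact div_self (pow_ne_zero _ (zmod_natCast_add_one_ne_zero hi))
    rw [sum_congr rfl h, e, sum_range_one_zmod]
    ring
  · intro j hj hj0
    rw [mem_range] at hj
    rcases Nat.eq_zero_or_pos j with rfl | hjpos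
    · simp only [mul_zero, pow_zero]
      rw [e, sum_range_inv_pow_zmod (by omega) (by omega), mul_zero]
    · have h : ∀ i ∈ range (2 * n), (i + 1 : ZMod p) ^ (2 * j) / (i + 1 : ZMod p) ^ 2 =
          (i + 1 : ZMod p) ^ (2 * j - 2) := by
        intro i hi
        rw [e, mem_range] at hi
        rw [div_eq_iff (pow_ne_zero _ (zmod_natCast_add_one_ne_zero hi)), ← pow_add]
        congr 1
        omega
      rw [sum_congr rfl h, e, sum_range_pow_zmod (by omega) (by omega), mul_zero]

/-- Reversing the order, 2(n-1-i) + 1 = p - 2(i+1). -/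
theorem sum_odd_eq_sum_neg_even {n : ℕ} (hpn : p = 2 * n + 1) (f : ZMod p → ZMod p) :
    ∑ i ∈ range n, f (2 * i + 1) = ∑ i ∈ range n, f (-(2 * (i + 1))) := by
  rw [← sum_range_reflect (fun i : ℕ => f (2 * (i : ZMod p) + 1))]
  refine sum_congr rfl fun i hi => ?_
  rw [mem_range] at hi
  congr 1
  have h := zmod_two_mul_add_one hpn
  rw [Nat.cast_sub (by omega), Nat.cast_sub (by omega)]
  push_cast
  linear_combination h

theorem sum_range_even_function {n : ℕ} (hpn : p = 2 * n + 1) (f : ZMod p → ZMod p)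
    (hf : ∀ x, f (-x) = f x) :
    ∑ i ∈ range (2 * n), f (i + 1) = 2 * ∑ i ∈ range n, f (i + 1) := by
  rw [sum_range_two_mul_reflect, two_mul (Finset.sum _ _)]
  congr 1
  refine sum_congr rfl fun i hi => ?_
  rw [mem_range] at hi
  rw [← hf]
  congr 1
  have h := zmod_two_mul_add_one hpn
  rw [Nat.cast_sub (by omega), Nat.cast_sub (by omega)]
  push_cast
  linear_combination -h

/-- The odd numbers below p represent each pair ±x exactly once. -/
theorem sum_range_even_function_odd {n : ℕ} (hpn : p = 2 * n + 1) (f : ZMod p → ZMod p)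
    (hf : ∀ x, f (-x) = f x) :
    ∑ i ∈ range (2 * n), f (i + 1) = 2 * ∑ i ∈ range n, f (2 * i + 1) := by
  rw [sum_range_two_mul_parity, two_mul]
  push_cast
  congr 1
  rw [sum_odd_eq_sum_neg_even hpn]
  refine sum_congr rfl fun i _ => ?_
  rw [hf]
  congr 1
  ring

end ModPrime

/-- The generalised harmonic number `∑_{j ≤ m} 1 / j ^ r`. -/
def harmonicSum (K : Type*) [Field K] (r m : ℕ) : K :=
  ∑ j ∈ range m, 1 / ((j : K) + 1) ^ r

/-- The sum `∑_{j ≤ m} 1 / (2 j - 1)` of reciprocals of odd numbers. -/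
def oddHarmonic (K : Type*) [Field K] (m : ℕ) : K :=
  ∑ j ∈ range m, 1 / (2 * (j : K) + 1)

/-- The product `∏_{j ≤ k} ((2 j - 1) / (2 j)) ^ 2`, that is `(C(2k, k) / 4 ^ k) ^ 2`. -/
def centralTerm (K : Type*) [Field K] (k : ℕ) : K :=
  ∏ j ∈ range k, ((2 * (j : K) + 1) / (2 * j + 2)) ^ 2

theorem centralTerm_succ (K : Type*) [Field K] (k : ℕ) :
    centralTerm K (k + 1) = centralTerm K k * ((2 * (k : K) + 1) / (2 * k + 2)) ^ 2 :=
  prod_range_succ _ _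

/-! ### Sums involving c_k as coefficients of interpolating polynomials modulo p. -/

section Interpolation

open Polynomial

theorem coeff_zero_prod_one_sub {K : Type*} [Field K] (b : ℕ → K) (k : ℕ) :
    (∏ j ∈ range k, (1 - C (b j) * X : K[X])).coeff 0 = 1 := by
  rw [coeff_zero_eq_eval_zero, eval_prod]
  simp

theorem coeff_one_prod_one_sub {K : Type*} [Field K] (b : ℕ → K) (k : ℕ) :
    (∏ j ∈ range k, (1 - C (b j) * X : K[X])).coeff 1 = -∑ j ∈ range k, b j := by
  induction k with
  | zero => simp [coeff_one]
  | succ k ih =>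
    have h := coeff_zero_prod_one_sub b k
    rw [prod_range_succ, sum_range_succ, mul_sub, mul_one, coeff_sub, ih, mul_left_comm,
      coeff_C_mul, coeff_mul_X, h]
    ring

variable {p : ℕ} [hp : Fact p.Prime]

theorem natDegree_prod_linear_le {K : Type*} [Field K] (b c : ℕ → K) (k : ℕ) :
    (∏ j ∈ range k, (C (c j) - C (b j) * X : K[X])).natDegree ≤ k := by
  refine (natDegree_prod_le _ _).trans ?_
  calc _ ≤ ∑ _j ∈ range k, 1 := sum_le_sum fun j _ => by
        refine (natDegree_sub_le _ _).trans ?_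
        simp only [natDegree_C, zero_le, sup_of_le_right]
        exact (natDegree_C_mul_le _ _).trans natDegree_X_le
    _ = k := by simp

/-- The left side is minus the linear coefficient of the Newton interpolant P with P((2m+1)²) =
1/(2m+1) for m < n. Summing P(x²)/x² over nonzero residues turns it into 2∑ 1/(2m+1)³. -/
theorem sum_centralTerm_odd_sq {n : ℕ} (hpn : p = 2 * n + 1) (hn : 1 < n) :
    ∑ k ∈ range n, centralTerm (ZMod p) k / (2 * k + 1) *
      ∑ j ∈ range k, 1 / (2 * (j : ZMod p) + 1) ^ 2 =
      -(1 / 4) * harmonicSum (ZMod p) 3 n := by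
  have h2 : (2 : ZMod p) ≠ 0 := zmod_two_ne_zero (by omega)
  set P : (ZMod p)[X] := ∑ k ∈ range n, C (centralTerm (ZMod p) k / (2 * k + 1)) *
    ∏ j ∈ range k, (C 1 - C (1 / (2 * (j : ZMod p) + 1) ^ 2) * X) with hPdef
  have hdeg : P.natDegree < n := by
    have : P.natDegree ≤ n - 1 := by
      refine natDegree_sum_le_of_forall_le _ _ fun k hk => ?_
      rw [mem_range] at hk
      refine (natDegree_C_mul_le _ _).trans ((natDegree_prod_linear_le _ _ _).trans ?_)
      omega
    omega
  have heval : ∀ m ∈ range n, P.eval ((2 * (m : ZMod p) + 1) ^ 2) = 1 / (2 * m + 1) := by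
    intro m hm
    rw [mem_range] at hm
    rw [← sum_prod_odd_sq_sub (zmod_natCast_ne_zero (p := p)) h2 m (by omega), hPdef,
      eval_finsetSum]
    symm
    -- For k > m the factor j = m of the Newton product vanishes at this node, so the sum stops at
    -- m.
    refine (sum_subset_zero_on_sdiff (range_subset_range.2 hm) ?_ ?_)
    · intro k hk
      rw [mem_sdiff, mem_range, mem_range] at hk
      rw [eval_mul, eval_prod]
      refine mul_eq_zero_of_right _ (prod_eq_zero (i := m) (mem_range.2 (by omega)) ?_)
      have h1 := natCast_two_mul_add_one_ne_zero (zmod_natCast_ne_zero (p := p))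
        (show 2 * m + 1 < p by omega)
      simp only [eval_sub, eval_mul, eval_C, eval_X]
      field_simp
      ring
    · intro k hk
      rw [mem_range] at hk
      rw [eval_mul, eval_prod, eval_C, centralTerm, div_mul_eq_mul_div, ← prod_mul_distrib]
      congr 1
      refine prod_congr rfl fun j hj => ?_
      rw [mem_range] at hj
      have h1 := natCast_two_mul_add_one_ne_zero (zmod_natCast_ne_zero (p := p))
        (show 2 * j + 1 < p by omega)
      simp only [eval_sub, eval_mul, eval_C, eval_X, div_pow]
      field_simp
  have hcoeff : P.coeff 1 = -∑ k ∈ range n, centralTerm (ZMod p) k / (2 * k + 1) *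
      ∑ j ∈ range k, 1 / (2 * (j : ZMod p) + 1) ^ 2 := by
    rw [hPdef, finsetSum_coeff, ← sum_neg_distrib]
    refine sum_congr rfl fun k _ => ?_
    rw [coeff_C_mul, C_1, coeff_one_prod_one_sub]
    ring
  have hmain := sum_eval_sq_div_sq P hpn hn hdeg
  rw [hcoeff, neg_neg,
    sum_range_even_function_odd hpn (fun x => P.eval (x ^ 2) / x ^ 2) (by simp)] at hmain
  rw [← hmain]
  have h3 : ∀ i ∈ range n, P.eval ((2 * (i : ZMod p) + 1) ^ 2) / (2 * (i : ZMod p) + 1) ^ 2 =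
      (fun x => 1 / x ^ 3) (2 * (i : ZMod p) + 1) := by
    intro i hi
    rw [heval i hi, div_div]
    congr 1
    ring
  rw [sum_congr rfl h3, sum_odd_eq_sum_neg_even hpn (fun x => 1 / x ^ 3), harmonicSum, mul_sum, mul_sum]
  refine sum_congr rfl fun i hi => ?_
  rw [mem_range] at hi
  have h1 : (i + 1 : ZMod p) ≠ 0 := zmod_natCast_add_one_ne_zero (by omega)
  have h4 : (4 : ZMod p) ≠ 0 := by
    rw [show (4 : ZMod p) = 2 * 2 by norm_num]
    exact mul_ne_zero h2 h2
  field_simp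
  ring

theorem prod_sq_div_odd_sq {n : ℕ} (hpn : p = 2 * n + 1) {k : ℕ} (hk : k < n) :
    1 / ((k : ZMod p) + 1) * (∏ j ∈ range (k + 1), 4 / (2 * (j : ZMod p) + 1) ^ 2) *
      ∏ j ∈ range k, ((j : ZMod p) + 1) ^ 2 =
      1 / (((k : ZMod p) + 1) ^ 3 * centralTerm (ZMod p) (k + 1)) := by
  have h2 : (2 : ZMod p) ≠ 0 := zmod_two_ne_zero (by omega)
  have h0 : (k + 1 : ZMod p) ≠ 0 := zmod_natCast_add_one_ne_zero (by omega)
  have h : (∏ j ∈ range (k + 1), 4 / (2 * (j : ZMod p) + 1) ^ 2) *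
      ∏ j ∈ range (k + 1), ((j : ZMod p) + 1) ^ 2 = 1 / centralTerm (ZMod p) (k + 1) := by
    rw [centralTerm, ← prod_mul_distrib, one_div, ← prod_inv_distrib]
    refine prod_congr rfl fun j hj => ?_
    rw [mem_range] at hj
    have h1 := natCast_two_mul_add_one_ne_zero (zmod_natCast_ne_zero (p := p))
      (show 2 * j + 1 < p by omega)
    have h3 : (j + 1 : ZMod p) ≠ 0 := zmod_natCast_add_one_ne_zero (by omega)
    rw [show (2 * j + 2 : ZMod p) = 2 * (j + 1) by ring]
    field_simp
    ring
  rw [prod_range_succ (fun j : ℕ => ((j : ZMod p) + 1) ^ 2)] at h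
  rw [← one_div_mul_one_div, ← h]
  field_simp

/-- The left side is the constant coefficient of Q, whose values at the squares (m+1)² are supplied
by `sum_halfTerm_div`. -/
theorem sum_one_div_centralTerm {n : ℕ} (hpn : p = 2 * n + 1) (hn : 0 < n) :
    ∑ k ∈ range n, 1 / (((k : ZMod p) + 1) ^ 3 * centralTerm (ZMod p) (k + 1)) =
      -8 * ∑ m ∈ range n, oddHarmonic (ZMod p) (m + 1) / ((m : ZMod p) + 1) ^ 2 := by
  set Q : (ZMod p)[X] := ∑ k ∈ range n,
    C (1 / ((k : ZMod p) + 1) * ∏ j ∈ range (k + 1), 4 / (2 * (j : ZMod p) + 1) ^ 2) *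
      ∏ j ∈ range k, (C (((j : ZMod p) + 1) ^ 2) - C 1 * X) with hQdef
  have hdeg : Q.natDegree < n := by
    have : Q.natDegree ≤ n - 1 := by
      refine natDegree_sum_le_of_forall_le _ _ fun k hk => ?_
      rw [mem_range] at hk
      refine (natDegree_C_mul_le _ _).trans ((natDegree_prod_linear_le _ _ _).trans ?_)
      omega
    omega
  have hcoeff : Q.coeff 0 =
      ∑ k ∈ range n, 1 / (((k : ZMod p) + 1) ^ 3 * centralTerm (ZMod p) (k + 1)) := by
    rw [coeff_zero_eq_eval_zero, hQdef, eval_finsetSum]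
    refine sum_congr rfl fun k hk => ?_
    rw [← prod_sq_div_odd_sq hpn (mem_range.1 hk), eval_mul, eval_C, eval_prod]
    simp
  have heval : ∀ m ∈ range n, Q.eval (((m : ZMod p) + 1) ^ 2) =
      4 * (oddHarmonic (ZMod p) (m + 1) / ((m : ZMod p) + 1) ^ 2) := by
    intro m hm
    rw [mem_range] at hm
    have h0 : (m + 1 : ZMod p) ≠ 0 := zmod_natCast_add_one_ne_zero (by omega)
    have h := sum_halfTerm_div (zmod_natCast_ne_zero (p := p)) (m + 1) (by omega)
    have hext : ∑ k ∈ range n, halfTerm (ZMod p) (m + 1) (k + 1) / (k + 1) =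
        ∑ k ∈ range (m + 1), halfTerm (ZMod p) (m + 1) (k + 1) / (k + 1) := by
      symm
      refine sum_subset (range_subset_range.2 hm) fun k _ hk => ?_
      rw [mem_range] at hk
      rw [halfTerm_eq_zero (by omega), zero_div]
    -- The factor j = 0 of `halfTerm` contributes -(m+1)², which is absent from Q.
    have hQ : -((m : ZMod p) + 1) ^ 2 * Q.eval (((m : ZMod p) + 1) ^ 2) =
        ∑ k ∈ range n, halfTerm (ZMod p) (m + 1) (k + 1) / (k + 1) := by
      rw [hQdef, eval_finsetSum, mul_sum]
      refine sum_congr rfl fun k _ => ?_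
      have hh : halfTerm (ZMod p) (m + 1) (k + 1) =
          (∏ j ∈ range (k + 1), 4 / (2 * (j : ZMod p) + 1) ^ 2) *
            ((∏ j ∈ range k, (((j : ZMod p) + 1) ^ 2 - ((m : ZMod p) + 1) ^ 2)) *
            -((m : ZMod p) + 1) ^ 2) := by
        have : (∏ j ∈ range k, (((j : ZMod p) + 1) ^ 2 - ((m : ZMod p) + 1) ^ 2)) *
            -((m : ZMod p) + 1) ^ 2 =
            ∏ j ∈ range (k + 1), ((j : ZMod p) ^ 2 - ((m : ZMod p) + 1) ^ 2) := by
          rw [prod_range_succ']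
          push_cast
          ring
        rw [this, halfTerm, ← prod_mul_distrib]
        refine prod_congr rfl fun j _ => ?_
        push_cast
        ring
      rw [hh, eval_mul, eval_C, eval_prod]
      simp only [eval_sub, eval_mul, eval_C, eval_X, one_mul]
      ring
    rw [hext, h] at hQ
    rw [mul_div_assoc', eq_div_iff (pow_ne_zero _ h0), oddHarmonic]
    linear_combination -hQ
  have hmain := sum_eval_sq Q hpn hdeg
  rw [hcoeff, sum_range_even_function hpn (fun x => Q.eval (x ^ 2)) (by simp),
    sum_congr rfl heval, ← mul_sum] at hmain
  linear_combination hmain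

end Interpolation

/-! ### Double harmonic sums over a field. -/

section HarmonicField

variable {K : Type*} [Field K]

theorem harmonicSum_succ (r m : ℕ) :
    harmonicSum K r (m + 1) = harmonicSum K r m + 1 / ((m : K) + 1) ^ r :=
  sum_range_succ _ _

theorem oddHarmonic_succ (m : ℕ) :
    oddHarmonic K (m + 1) = oddHarmonic K m + 1 / (2 * (m : K) + 1) :=
  sum_range_succ _ _

/-- The double sum `∑_{j < s ≤ m} 1 / (j s²)`. -/
def doubleHarmonic (K : Type*) [Field K] (m : ℕ) : K :=
  ∑ s ∈ range m, harmonicSum K 1 s / ((s : K) + 1) ^ 2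

/-- The double sum `∑_{j < s ≤ m} 1 / (j² s)`. -/
def doubleHarmonic' (K : Type*) [Field K] (m : ℕ) : K :=
  ∑ s ∈ range m, harmonicSum K 2 s / ((s : K) + 1)

theorem doubleHarmonic_succ (m : ℕ) :
    doubleHarmonic K (m + 1) = doubleHarmonic K m + harmonicSum K 1 m / ((m : K) + 1) ^ 2 :=
  sum_range_succ _ _

theorem doubleHarmonic'_succ (m : ℕ) :
    doubleHarmonic' K (m + 1) = doubleHarmonic' K m + harmonicSum K 2 m / ((m : K) + 1) :=
  sum_range_succ _ _

theorem doubleHarmonic_stuffle (m : ℕ) :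
    doubleHarmonic K m + doubleHarmonic' K m + harmonicSum K 3 m =
      harmonicSum K 1 m * harmonicSum K 2 m := by
  induction m with
  | zero => simp [doubleHarmonic, doubleHarmonic', harmonicSum]
  | succ m ih =>
    rw [doubleHarmonic_succ, doubleHarmonic'_succ, harmonicSum_succ, harmonicSum_succ,
      harmonicSum_succ]
    generalize (m : K) + 1 = u
    linear_combination ih

theorem harmonicSum_one_reflect (m : ℕ) :
    ∑ i ∈ range m, 1 / ((m : K) - i) = harmonicSum K 1 m := by
  rw [harmonicSum, ← sum_range_reflect]
  refine sum_congr rfl fun i hi => ?_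
  rw [mem_range] at hi
  rw [Nat.cast_sub (by omega), Nat.cast_sub (by omega), pow_one]
  congr 1
  push_cast
  ring

/-- This is ∑ 1/(a²b) over a + b ≤ m. For a + b = s, partial fractions give 1/(a²b) = (1/a + 1/b)/s²
+ 1/(s a²); the induction adds the layer s = m + 1. -/
theorem sum_harmonicSum_reflect_div_sq {N : ℕ} (hN : ∀ j : ℕ, 0 < j → j < N → (j : K) ≠ 0)
    (m : ℕ) (hm : m < N) :
    ∑ i ∈ range m, harmonicSum K 1 (m - 1 - i) / ((i : K) + 1) ^ 2 =
      2 * doubleHarmonic K m + doubleHarmonic' K m := by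
  induction m with
  | zero => simp [doubleHarmonic, doubleHarmonic']
  | succ m ih =>
    have h0 := natCast_add_one_ne_zero hN hm
    have key : ∀ i ∈ range m, harmonicSum K 1 (m + 1 - 1 - i) / ((i : K) + 1) ^ 2 =
        harmonicSum K 1 (m - 1 - i) / ((i : K) + 1) ^ 2 +
          (1 / ((m : K) + 1) ^ 2 * (1 / ((m : K) - i) + 1 / ((i : K) + 1) ^ 1) +
            1 / ((m : K) + 1) * (1 / ((i : K) + 1) ^ 2)) := by
      intro i hi
      rw [mem_range] at hi
      have h1 := natCast_add_one_ne_zero hN (show i + 1 < N by omega)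
      have h2 : (m : K) - i ≠ 0 := by
        rw [← Nat.cast_sub hi.le]
        exact hN _ (by omega) (by omega)
      rw [show m + 1 - 1 - i = (m - 1 - i) + 1 by omega, harmonicSum_succ,
        Nat.cast_sub (by omega), Nat.cast_sub (by omega),
        show ((m : K) - (1 : ℕ) - i + 1) = m - i by push_cast; ring]
      field_simp
      ring
    rw [sum_range_succ, sum_congr rfl key, sum_add_distrib, ih (by omega), sum_add_distrib,
      ← mul_sum, ← mul_sum, sum_add_distrib, harmonicSum_one_reflect, doubleHarmonic_succ,
      doubleHarmonic'_succ]
    change _ + (_ * (_ + harmonicSum K 1 m) + _ * harmonicSum K 2 m) + _ = _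
    have h3 : harmonicSum K 1 (m + 1 - 1 - m) = 0 := by simp [harmonicSum]
    rw [h3]
    ring

theorem harmonicSum_one_two_mul {N : ℕ} (hN : ∀ j : ℕ, 0 < j → j < N → (j : K) ≠ 0)
    (h2 : (2 : K) ≠ 0) (m : ℕ) (hm : m < N) :
    harmonicSum K 1 (2 * m) = oddHarmonic K m + harmonicSum K 1 m / 2 := by
  induction m with
  | zero => simp [harmonicSum, oddHarmonic]
  | succ m ih =>
    have h0 := natCast_add_one_ne_zero hN hm
    rw [show 2 * (m + 1) = 2 * m + 1 + 1 by ring, harmonicSum_succ, harmonicSum_succ,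
      ih (by omega), oddHarmonic_succ, harmonicSum_succ]
    push_cast
    rw [show (2 * m + 1 + 1 : K) = 2 * (m + 1) by ring]
    field_simp
    ring

end HarmonicField

/-! ### Evaluating the double harmonic sums modulo p through H_3(n). -/

section HarmonicModPrime

variable {p : ℕ} [hp : Fact p.Prime]

theorem harmonicSum_one_sub_eq {n : ℕ} (hpn : p = 2 * n + 1) (hn : 1 < n) (m : ℕ)
    (hm : m ≤ 2 * n) :
    harmonicSum (ZMod p) 1 (2 * n - m) = harmonicSum (ZMod p) 1 m := by
  induction m with
  | zero =>
    have h := sum_range_inv_pow_zmod (p := p) one_ne_zero (by omega)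
    rw [show p - 1 = 2 * n by omega] at h
    simpa [harmonicSum] using h
  | succ m ih =>
    have h := ih (by omega)
    rw [show 2 * n - m = 2 * n - (m + 1) + 1 by omega, harmonicSum_succ,
      Nat.cast_sub hm] at h
    rw [harmonicSum_succ, ← h]
    have h0 := zmod_two_mul_add_one hpn
    have e : ((2 * n : ℕ) : ZMod p) - (m + 1 : ℕ) + 1 = -(m + 1) := by
      push_cast
      linear_combination h0
    rw [e, pow_one, pow_one, div_neg]
    ring

theorem harmonicSum_two_eq_zero {n : ℕ} (hpn : p = 2 * n + 1) (hn : 1 < n) :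
    harmonicSum (ZMod p) 2 n = 0 := by
  have h := sum_range_inv_pow_zmod (p := p) two_ne_zero (by omega)
  rw [show p - 1 = 2 * n by omega, sum_range_even_function hpn (fun x => 1 / x ^ 2) (by simp)] at h
  exact (mul_eq_zero.1 h).resolve_left (zmod_two_ne_zero (by omega))

theorem two_mul_oddHarmonic {n : ℕ} (hpn : p = 2 * n + 1) (m : ℕ) (hm : m ≤ n) :
    2 * oddHarmonic (ZMod p) m = harmonicSum (ZMod p) 1 (n - m) - harmonicSum (ZMod p) 1 n := by
  induction m with
  | zero => simp [oddHarmonic]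
  | succ m ih =>
    have h := ih (by omega)
    rw [show n - m = n - (m + 1) + 1 by omega, harmonicSum_succ, Nat.cast_sub hm] at h
    rw [oddHarmonic_succ, mul_add, h]
    have h0 := zmod_two_mul_add_one hpn
    have h1 := natCast_two_mul_add_one_ne_zero (zmod_natCast_ne_zero (p := p))
      (show 2 * m + 1 < p by omega)
    have h2 : (2 : ZMod p) ≠ 0 := zmod_two_ne_zero (by omega)
    have e : (n : ZMod p) - (m + 1 : ℕ) + 1 = -(2 * m + 1) / 2 := by
      push_cast
      rw [eq_div_iff h2]
      linear_combination h0
    rw [e, pow_one]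
    field_simp
    ring

/-- Modulo p, odd harmonic numbers are reflected ordinary ones; the sum becomes 2D(n) + D'(n) with
D' = `doubleHarmonic'`, and stuffle with H_2(n) = 0 eliminates D'. -/
theorem sum_oddHarmonic_div_sq {n : ℕ} (hpn : p = 2 * n + 1) (hn : 1 < n) :
    2 * ∑ m ∈ range n, oddHarmonic (ZMod p) (m + 1) / ((m : ZMod p) + 1) ^ 2 =
      doubleHarmonic (ZMod p) n - harmonicSum (ZMod p) 3 n := by
  have h1 := sum_harmonicSum_reflect_div_sq (zmod_natCast_ne_zero (p := p)) n (by omega)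
  have h2 := doubleHarmonic_stuffle (K := ZMod p) n
  have h3 := harmonicSum_two_eq_zero hpn hn
  have h4 : ∀ m ∈ range n, 2 * (oddHarmonic (ZMod p) (m + 1) / ((m : ZMod p) + 1) ^ 2) =
      harmonicSum (ZMod p) 1 (n - 1 - m) / ((m : ZMod p) + 1) ^ 2 -
        harmonicSum (ZMod p) 1 n * (1 / ((m : ZMod p) + 1) ^ 2) := by
    intro m hm
    rw [mem_range] at hm
    rw [← mul_div_assoc, two_mul_oddHarmonic hpn _ hm, show n - (m + 1) = n - 1 - m by omega]
    ring
  rw [mul_sum, sum_congr rfl h4, sum_sub_distrib, ← mul_sum, h1]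
  change _ - _ * harmonicSum (ZMod p) 2 n = _
  rw [h3] at h2 ⊢
  linear_combination h2

/-- Pair s with p - s: 1/s² is unchanged and H_1(p-s-1) becomes H_1(s). -/
theorem doubleHarmonic_full {n : ℕ} (hpn : p = 2 * n + 1) (hn : 1 < n) :
    doubleHarmonic (ZMod p) (2 * n) =
      2 * doubleHarmonic (ZMod p) n + harmonicSum (ZMod p) 3 n := by
  rw [doubleHarmonic, sum_range_two_mul_reflect, two_mul (doubleHarmonic _ _), add_assoc]
  congr 1
  rw [doubleHarmonic, harmonicSum, ← sum_add_distrib]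
  refine sum_congr rfl fun i hi => ?_
  rw [mem_range] at hi
  have h0 := zmod_two_mul_add_one hpn
  have e : ((2 * n - 1 - i : ℕ) : ZMod p) + 1 = -(i + 1) := by
    rw [Nat.cast_sub (by omega), Nat.cast_sub (by omega)]
    push_cast
    linear_combination h0
  rw [e, show 2 * n - 1 - i = 2 * n - (i + 1) by omega,
    harmonicSum_one_sub_eq hpn hn _ (by omega), harmonicSum_succ]
  generalize (i : ZMod p) + 1 = u
  ring

/-- Split s by parity and write odd s as p - 2(i+1), so that both halves have denominator 4(i+1)²;
H_1 at even arguments splits into an odd part and a halved part. -/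
theorem doubleHarmonic_full_parity {n : ℕ} (hpn : p = 2 * n + 1) (hn : 1 < n) :
    doubleHarmonic (ZMod p) (2 * n) =
      1 / 2 * doubleHarmonic (ZMod p) n - 1 / 8 * harmonicSum (ZMod p) 3 n := by
  have h2 : (2 : ZMod p) ≠ 0 := zmod_two_ne_zero (by omega)
  have h0 := zmod_two_mul_add_one hpn
  have hO := sum_oddHarmonic_div_sq hpn hn
  have key : doubleHarmonic (ZMod p) (2 * n) = ∑ i ∈ range n,
      (1 / 2 * (oddHarmonic (ZMod p) (i + 1) / ((i : ZMod p) + 1) ^ 2) +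
        (1 / 4 * (harmonicSum (ZMod p) 1 i / ((i : ZMod p) + 1) ^ 2) +
          1 / 8 * (1 / ((i : ZMod p) + 1) ^ 3))) := by
    rw [doubleHarmonic, sum_range_two_mul_parity,
      ← sum_range_reflect (fun i : ℕ =>
        harmonicSum (ZMod p) 1 (2 * i) / (((2 * i : ℕ) : ZMod p) + 1) ^ 2), ← sum_add_distrib]
    refine sum_congr rfl fun i hi => ?_
    rw [mem_range] at hi
    have h1 : (i + 1 : ZMod p) ≠ 0 := zmod_natCast_add_one_ne_zero (by omega)
    have e : ((2 * (n - 1 - i) : ℕ) : ZMod p) + 1 = -(2 * (i + 1)) := by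
      rw [Nat.cast_mul, Nat.cast_sub (by omega), Nat.cast_sub (by omega)]
      push_cast
      linear_combination h0
    have e3 := harmonicSum_succ (K := ZMod p) 1 (2 * i + 1)
    have e2 := harmonicSum_one_two_mul (zmod_natCast_ne_zero (p := p)) h2 (i + 1) (by omega)
    rw [show 2 * i + 1 + 1 = 2 * (i + 1) by ring, e2, harmonicSum_succ 1 i] at e3
    have e4 : harmonicSum (ZMod p) 1 (2 * i + 1) =
        oddHarmonic (ZMod p) (i + 1) + harmonicSum (ZMod p) 1 i / 2 := by
      push_cast at e3
      rw [show (2 * i + 1 + 1 : ZMod p) = 2 * (i + 1) by ring, pow_one, pow_one] at e3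
      have e5 : (1 : ZMod p) / (2 * (i + 1)) = 1 / (i + 1) / 2 := by field_simp
      rw [e5] at e3
      linear_combination -e3
    rw [e, show 2 * (n - 1 - i) = 2 * n - 2 * (i + 1) by omega,
      harmonicSum_one_sub_eq hpn hn _ (by omega), e2, e4, harmonicSum_succ]
    push_cast
    rw [show (2 * i + 1 + 1 : ZMod p) = 2 * (i + 1) by ring]
    have h4 : (4 : ZMod p) ≠ 0 := by
      rw [show (4 : ZMod p) = 2 * 2 by norm_num]
      exact mul_ne_zero h2 h2
    have h8 : (8 : ZMod p) ≠ 0 := by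
      rw [show (8 : ZMod p) = 4 * 2 by norm_num]
      exact mul_ne_zero h4 h2
    field_simp
    ring
  rw [key, sum_add_distrib, sum_add_distrib, ← mul_sum, ← mul_sum, ← mul_sum]
  change _ + (_ * doubleHarmonic (ZMod p) n + _ * harmonicSum (ZMod p) 3 n) = _
  have h4 : (4 : ZMod p) ≠ 0 := by
    rw [show (4 : ZMod p) = 2 * 2 by norm_num]
    exact mul_ne_zero h2 h2
  have h8 : (8 : ZMod p) ≠ 0 := by
    rw [show (8 : ZMod p) = 4 * 2 by norm_num]
    exact mul_ne_zero h4 h2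
  field_simp
  linear_combination 16 * hO

theorem four_mul_doubleHarmonic {n : ℕ} (hpn : p = 2 * n + 1) (hn : 1 < n) :
    4 * doubleHarmonic (ZMod p) n = -3 * harmonicSum (ZMod p) 3 n := by
  have h2 : (2 : ZMod p) ≠ 0 := zmod_two_ne_zero (by omega)
  have h3 : (3 : ZMod p) ≠ 0 := by
    exact_mod_cast zmod_natCast_ne_zero (p := p) 3 (by omega) (by omega)
  have h8 : (8 : ZMod p) ≠ 0 := by
    rw [show (8 : ZMod p) = 2 ^ 3 by norm_num]
    exact pow_ne_zero _ h2
  have h := (doubleHarmonic_full hpn hn).symm.trans (doubleHarmonic_full_parity hpn hn)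
  field_simp at h
  -- The two evaluations differ by (3/8)(4D + 3H_3), so 3 has to be invertible.
  refine mul_left_cancel₀ (mul_ne_zero h2 h3) ?_
  linear_combination h

theorem two_mul_doubleHarmonic_full {n : ℕ} (hpn : p = 2 * n + 1) (hn : 1 < n) :
    2 * doubleHarmonic (ZMod p) (2 * n) = -harmonicSum (ZMod p) 3 n := by
  rw [doubleHarmonic_full hpn hn]
  linear_combination four_mul_doubleHarmonic hpn hn

theorem sum_one_div_centralTerm_eq {n : ℕ} (hpn : p = 2 * n + 1) (hn : 1 < n) :
    ∑ k ∈ range n, 1 / (((k : ZMod p) + 1) ^ 3 * centralTerm (ZMod p) (k + 1)) =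
      7 * harmonicSum (ZMod p) 3 n := by
  rw [sum_one_div_centralTerm hpn (by omega)]
  linear_combination -4 * sum_oddHarmonic_div_sq hpn hn - four_mul_doubleHarmonic hpn hn

end HarmonicModPrime

/-! ### The p-integral rationals and their reduction modulo p. -/

section PIntegral

/-- The ring of rational numbers whose reduced denominator is not divisible by `p`. -/
def pIntegralRat (p : ℕ) [hp : Fact p.Prime] : Subring ℚ where
  carrier := {q | ¬ p ∣ q.den}
  zero_mem' := by simpa using hp.out.one_lt.ne'
  one_mem' := by simpa using hp.out.one_lt.ne'
  add_mem' {a b} ha hb h := by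
    rcases (hp.out.dvd_mul).1 (h.trans (Rat.add_den_dvd a b)) with h | h
    exacts [ha h, hb h]
  mul_mem' {a b} ha hb h := by
    rcases (hp.out.dvd_mul).1 (h.trans (Rat.mul_den_dvd a b)) with h | h
    exacts [ha h, hb h]
  neg_mem' {a} ha := by simpa using ha

variable {p : ℕ} [hp : Fact p.Prime]

theorem mem_pIntegralRat {q : ℚ} : q ∈ pIntegralRat p ↔ ¬ p ∣ q.den := Iff.rfl

theorem den_cast_ne_zero {q : ℚ} (hq : q ∈ pIntegralRat p) : (q.den : ZMod p) ≠ 0 := by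
  rwa [Ne, ZMod.natCast_eq_zero_iff]

theorem div_natCast_mem {q : ℚ} (hq : q ∈ pIntegralRat p) {m : ℕ} (hm : ¬ p ∣ m) :
    q / m ∈ pIntegralRat p := by
  rw [div_eq_mul_inv]
  refine mul_mem hq ?_
  have h0 : m ≠ 0 := by
    rintro rfl
    exact hm (dvd_zero p)
  rw [mem_pIntegralRat, Rat.inv_natCast_den, if_neg h0]
  exact hm

/-- Reduction modulo `p` of `p`-integral rational numbers. -/
def pIntegralRatToZMod (p : ℕ) [Fact p.Prime] : pIntegralRat p →+* ZMod p where
  toFun q := ((q : ℚ) : ZMod p)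
  map_zero' := by simp
  map_one' := by simp
  map_add' a b := by
    simpa using Rat.cast_add_of_ne_zero (den_cast_ne_zero a.2) (den_cast_ne_zero b.2)
  map_mul' a b := by
    simpa using Rat.cast_mul_of_ne_zero (den_cast_ne_zero a.2) (den_cast_ne_zero b.2)

theorem zmodCast_add {a b : ℚ} (ha : a ∈ pIntegralRat p) (hb : b ∈ pIntegralRat p) :
    ((a + b : ℚ) : ZMod p) = a + b :=
  Rat.cast_add_of_ne_zero (den_cast_ne_zero ha) (den_cast_ne_zero hb)

theorem zmodCast_mul {a b : ℚ} (ha : a ∈ pIntegralRat p) (hb : b ∈ pIntegralRat p) :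
    ((a * b : ℚ) : ZMod p) = a * b :=
  Rat.cast_mul_of_ne_zero (den_cast_ne_zero ha) (den_cast_ne_zero hb)

theorem zmodCast_sub {a b : ℚ} (ha : a ∈ pIntegralRat p) (hb : b ∈ pIntegralRat p) :
    ((a - b : ℚ) : ZMod p) = a - b := by
  rw [sub_eq_add_neg, zmodCast_add ha (neg_mem hb), Rat.cast_neg, sub_eq_add_neg]

theorem zmodCast_pow {a : ℚ} (ha : a ∈ pIntegralRat p) (m : ℕ) :
    ((a ^ m : ℚ) : ZMod p) = (a : ZMod p) ^ m :=
  map_pow (pIntegralRatToZMod p) ⟨a, ha⟩ m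

theorem zmodCast_div_natCast {a : ℚ} (ha : a ∈ pIntegralRat p) {m : ℕ} (hm : ¬ p ∣ m) :
    ((a / m : ℚ) : ZMod p) = a / m := by
  have h0 : (m : ZMod p) ≠ 0 := by rwa [Ne, ZMod.natCast_eq_zero_iff]
  have h1 : (m : ℚ) ≠ 0 := by
    rintro h
    rw [Nat.cast_eq_zero] at h
    exact hm (h ▸ dvd_zero p)
  have h := zmodCast_mul (div_natCast_mem ha hm) (natCast_mem _ m)
  rw [div_mul_cancel₀ _ h1, Rat.cast_natCast] at h
  rw [eq_div_iff h0, h]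

theorem zmodCast_sum {ι : Type*} (s : Finset ι) (f : ι → ℚ) (hf : ∀ i ∈ s, f i ∈ pIntegralRat p) :
    ((∑ i ∈ s, f i : ℚ) : ZMod p) = ∑ i ∈ s, (f i : ZMod p) := by
  classical
  induction s using Finset.induction_on with
  | empty => simp
  | insert a s ha ih =>
    have h1 : ∀ i ∈ s, f i ∈ pIntegralRat p := fun i hi => hf i (mem_insert_of_mem hi)
    rw [sum_insert ha, sum_insert ha, zmodCast_add (hf a (mem_insert_self _ _)) (sum_mem h1), ih h1]

theorem exists_eq_mul_of_zmodCast_eq_zero {q : ℚ} (hq : q ∈ pIntegralRat p)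
    (h : (q : ZMod p) = 0) : ∃ c ∈ pIntegralRat p, q = p * c := by
  rw [Rat.cast_def, div_eq_zero_iff] at h
  have h1 := h.resolve_right (den_cast_ne_zero hq)
  rw [ZMod.intCast_zmod_eq_zero_iff_dvd] at h1
  obtain ⟨c, hc⟩ := h1
  refine ⟨c / q.den, div_natCast_mem (intCast_mem _ c) hq, ?_⟩
  nth_rewrite 1 [← Rat.num_div_den q]
  rw [hc]
  push_cast
  ring

theorem ratModEq_one_of_zmodCast_eq {a b : ℚ} (ha : a ∈ pIntegralRat p) (hb : b ∈ pIntegralRat p)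
    (h : (a : ZMod p) = b) : RatModEq p 1 a b := by
  obtain ⟨c, hc, e⟩ := exists_eq_mul_of_zmodCast_eq_zero (sub_mem ha hb)
    (by rw [zmodCast_sub ha hb, h, sub_self])
  exact ⟨c, hc, by rw [e, pow_one]⟩

/-- The Bernoulli recursion for B_i divides only by i + 1, which is less than p. -/
theorem bernoulli_mem {i : ℕ} (hi : i < p - 1) : bernoulli i ∈ pIntegralRat p := by
  induction i using Nat.strong_induction_on with
  | _ i ih =>
    rcases Nat.eq_zero_or_pos i with rfl | hpos
    · simp
    have h := sum_bernoulli (i + 1)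
    rw [sum_range_succ, if_neg (by omega), Nat.choose_succ_self_right] at h
    have h0 : ((i + 1 : ℕ) : ℚ) ≠ 0 := by positivity
    have e : bernoulli i =
        (-∑ k ∈ range i, ((i + 1).choose k : ℚ) * bernoulli k) / (i + 1 : ℕ) := by
      rw [eq_div_iff h0]
      linear_combination h
    rw [e]
    refine div_natCast_mem (neg_mem (sum_mem fun k hk => ?_))
      (Nat.not_dvd_of_pos_of_lt (by omega) (by omega))
    rw [mem_range] at hk
    exact mul_mem (natCast_mem _ _) (ih k hk (by omega))

end PIntegral

/-! ### From harmonic sums to B_{p-3}. -/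

section Bernoulli

variable {p : ℕ} [hp : Fact p.Prime]

/-- Makes the division by p - 1 in Faulhaber's formula a change of sign. -/
theorem zmod_natCast_prime_sub_one : ((p - 1 : ℕ) : ZMod p) = -1 := by
  rw [Nat.cast_sub hp.out.one_le]
  simp

/-- By Fermat 1/k = k^(p-2), so Faulhaber's formula applies. -/
theorem harmonicSum_one_eq_sum_bernoulli (h3 : 3 < p) {s : ℕ} (hs : s < p) :
    harmonicSum (ZMod p) 1 s = -∑ i ∈ range (p - 1),
      (bernoulli i : ZMod p) * ((p - 1).choose i : ZMod p) * (s + 1 : ZMod p) ^ (p - 1 - i) := by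
  have h := congrArg (Rat.cast : ℚ → ZMod p) (sum_range_pow (s + 1) (p - 2))
  rw [show p - 2 + 1 = p - 1 by omega,
    show ((p - 2 : ℕ) : ℚ) + 1 = (p - 1 : ℕ) by
      rw [show p - 1 = p - 2 + 1 by omega]; push_cast; ring] at h
  have hp1 : ¬ p ∣ p - 1 := Nat.not_dvd_of_pos_of_lt (by omega) (by omega)
  have hmem : ∀ i ∈ range (p - 1),
      bernoulli i * ((p - 1).choose i : ℚ) * ((s + 1 : ℕ) : ℚ) ^ (p - 1 - i) ∈ pIntegralRat p := by
    intro i hi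
    exact mul_mem (mul_mem (bernoulli_mem (mem_range.1 hi)) (natCast_mem _ _))
      (pow_mem (natCast_mem _ _) _)
  rw [zmodCast_sum _ _ fun k _ => pow_mem (natCast_mem _ _) _,
    zmodCast_sum _ _ fun i hi => div_natCast_mem (hmem i hi) hp1, sum_range_succ'] at h
  have e1 : harmonicSum (ZMod p) 1 s =
      ∑ k ∈ range s, ((((k + 1 : ℕ) : ℚ) ^ (p - 2) : ℚ) : ZMod p) := by
    refine sum_congr rfl fun k hk => ?_
    rw [mem_range] at hk
    rw [zmod_inv_pow (zmod_natCast_add_one_ne_zero (by omega)) (by omega),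
      zmodCast_pow (natCast_mem _ _), Rat.cast_natCast, show p - 1 - 1 = p - 2 by omega]
    push_cast
    rfl
  have e2 : (((((0 : ℕ) : ℚ) ^ (p - 2) : ℚ)) : ZMod p) = 0 := by
    rw [Nat.cast_zero, zero_pow (by omega), Rat.cast_zero]
  rw [e1, ← sum_neg_distrib]
  rw [e2, add_zero] at h
  rw [h]
  refine sum_congr rfl fun i hi => ?_
  have hB := bernoulli_mem (mem_range.1 hi)
  rw [zmodCast_div_natCast (hmem i hi) hp1,
    zmodCast_mul (mul_mem hB (natCast_mem _ _)) (pow_mem (natCast_mem _ _) _),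
    zmodCast_mul hB (natCast_mem _ _), zmodCast_pow (natCast_mem _ _), Rat.cast_natCast,
    Rat.cast_natCast, zmod_natCast_prime_sub_one, div_neg, div_one]
  push_cast
  ring

theorem choose_sub_three (h3 : 3 < p) : ((p - 1).choose (p - 3) : ZMod p) = 1 := by
  have h2 : (2 : ZMod p) ≠ 0 := zmod_two_ne_zero (by omega)
  have h := Nat.choose_symm (n := p - 1) (k := 2) (by omega)
  rw [show p - 1 - 2 = p - 3 by omega] at h
  have h4 := Nat.choose_succ_right_eq (p - 1) 1
  have h5 := congrArg (Nat.cast : ℕ → ZMod p) h4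
  rw [Nat.choose_one_right] at h5
  push_cast at h5
  rw [zmod_natCast_prime_sub_one, show p - 1 - 1 = p - 2 by omega, Nat.cast_sub (by omega)] at h5
  rw [h]
  refine mul_right_cancel₀ h2 ?_
  rw [h5]
  simp

/-- After Faulhaber, the coefficient of B_i is a power sum of exponent p-3-i, nonzero only for i =
p-3. -/
theorem doubleHarmonic_eq_bernoulli (h3 : 3 < p) :
    doubleHarmonic (ZMod p) (p - 1) = (bernoulli (p - 3) : ZMod p) := by
  have key : ∀ s ∈ range (p - 1), harmonicSum (ZMod p) 1 s / ((s : ZMod p) + 1) ^ 2 =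
      ∑ i ∈ range (p - 1), -((bernoulli i : ZMod p) * ((p - 1).choose i : ZMod p)) *
        ((s + 1 : ZMod p) ^ (p - 1 - i) / (s + 1 : ZMod p) ^ 2) := by
    intro s hs
    rw [mem_range] at hs
    rw [harmonicSum_one_eq_sum_bernoulli h3 (by omega), ← sum_neg_distrib, sum_div]
    refine sum_congr rfl fun i _ => ?_
    ring
  rw [doubleHarmonic, sum_congr rfl key, sum_comm]
  simp_rw [← mul_sum]
  have hpow : ∀ i, i < p - 2 → ∑ s ∈ range (p - 1),
      (s + 1 : ZMod p) ^ (p - 1 - i) / (s + 1 : ZMod p) ^ 2 =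
      ∑ s ∈ range (p - 1), (s + 1 : ZMod p) ^ (p - 3 - i) := by
    intro i hi
    refine sum_congr rfl fun s hs => ?_
    have h0 := zmod_natCast_add_one_ne_zero (mem_range.1 hs)
    rw [div_eq_iff (pow_ne_zero _ h0), ← pow_add]
    congr 1
    omega
  rw [sum_eq_single_of_mem (p - 3) (mem_range.2 (by omega))]
  · rw [hpow _ (by omega), Nat.sub_self, choose_sub_three h3]
    simp_rw [pow_zero]
    rw [sum_range_one_zmod]
    ring
  · intro i hi hne
    rw [mem_range] at hi
    by_cases hi2 : i < p - 2
    · rw [hpow i hi2]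
      rcases Nat.eq_zero_or_pos i with rfl | hpos
      · rw [sum_range_pow_zmod (by omega) (by omega), mul_zero]
      · rw [sum_range_pow_zmod (by omega) (by omega), mul_zero]
    -- The remaining index i = p-2 gives exponent -1; its power sum vanishes too.
    · have e : ∑ s ∈ range (p - 1), (s + 1 : ZMod p) ^ (p - 1 - i) / (s + 1 : ZMod p) ^ 2 =
          ∑ s ∈ range (p - 1), 1 / (s + 1 : ZMod p) ^ 1 := by
        refine sum_congr rfl fun s hs => ?_
        have h0 := zmod_natCast_add_one_ne_zero (mem_range.1 hs)
        rw [show p - 1 - i = 1 by omega]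
        field_simp
      rw [e, sum_range_inv_pow_zmod one_ne_zero (by omega), mul_zero]

theorem harmonicSum_three_eq_bernoulli {n : ℕ} (hpn : p = 2 * n + 1) (hn : 1 < n) :
    harmonicSum (ZMod p) 3 n = -2 * (bernoulli (p - 3) : ZMod p) := by
  have h := doubleHarmonic_eq_bernoulli (p := p) (by omega)
  rw [show p - 1 = 2 * n by omega] at h
  have h2 := two_mul_doubleHarmonic_full hpn hn
  rw [h] at h2
  linear_combination h2

end Bernoulli

/-! ### Central binomial coefficients modulo p and the two reflections. -/

section Central

theorem centralTerm_mul_pow {K : Type*} [Field K] {N : ℕ}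
    (hN : ∀ j : ℕ, 0 < j → j < N → (j : K) ≠ 0) (h2 : (2 : K) ≠ 0) (k : ℕ) (hk : k < N) :
    centralTerm K k * 16 ^ k = ((2 * k).choose k : K) ^ 2 := by
  change _ = (k.centralBinom : K) ^ 2
  induction k with
  | zero => simp [centralTerm]
  | succ k ih =>
    have h1 := natCast_add_one_ne_zero hN hk
    have h := congrArg (Nat.cast : ℕ → K) (Nat.succ_mul_centralBinom_succ k)
    push_cast at h
    have e : ((k + 1).centralBinom : K) = 2 * (2 * k + 1) * k.centralBinom / (k + 1) := by
      rw [eq_div_iff h1]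
      linear_combination h
    rw [e, centralTerm_succ, pow_succ]
    have e2 : (2 * k + 2 : K) = 2 * (k + 1) := by ring
    rw [e2]
    field_simp
    linear_combination (2 * (k : K) + 1) ^ 2 * 16 * ih (by omega)

variable {p : ℕ} [hp : Fact p.Prime]

/-- Modulo p, n = -1/2 and C(-1/2,k) = (-1)^k C(2k,k)/4^k. This yields the symmetry c_k = c_{n-k}.
-/
theorem centralTerm_eq_choose_sq {n : ℕ} (hpn : p = 2 * n + 1) (hn : 0 < n) (k : ℕ) (hk : k ≤ n) :
    centralTerm (ZMod p) k = (n.choose k : ZMod p) ^ 2 := by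
  induction k with
  | zero => simp [centralTerm]
  | succ k ih =>
    have h2 : (2 : ZMod p) ≠ 0 := zmod_two_ne_zero (by omega)
    have h1 : (k + 1 : ZMod p) ≠ 0 := zmod_natCast_add_one_ne_zero (by omega)
    have h := congrArg (Nat.cast : ℕ → ZMod p) (Nat.choose_succ_right_eq n k)
    have h0 := zmod_two_mul_add_one hpn
    push_cast [Nat.cast_sub (show k ≤ n by omega)] at h
    have e : (n.choose (k + 1) : ZMod p) = n.choose k * (-(2 * k + 1) / 2) / (k + 1) := by
      rw [eq_div_iff h1, h]
      congr 1
      rw [eq_div_iff h2]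
      linear_combination h0
    rw [e, centralTerm_succ, ih (by omega)]
    have e2 : (2 * k + 2 : ZMod p) = 2 * (k + 1) := by ring
    rw [e2]
    field_simp

theorem eight_mul_sum_odd_cube {n : ℕ} (hpn : p = 2 * n + 1) (hn : 1 < n) :
    8 * ∑ k ∈ range n, 1 / ((2 * (k : ZMod p) + 1) ^ 3 * centralTerm (ZMod p) k) =
      -7 * harmonicSum (ZMod p) 3 n := by
  have h2 : (2 : ZMod p) ≠ 0 := zmod_two_ne_zero (by omega)
  rw [neg_mul, ← sum_one_div_centralTerm_eq hpn hn, ← sum_neg_distrib, ← sum_range_reflect, mul_sum]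
  refine sum_congr rfl fun i hi => ?_
  rw [mem_range] at hi
  have h0 := zmod_two_mul_add_one hpn
  have e : 2 * ((n - 1 - i : ℕ) : ZMod p) + 1 = -(2 * (i + 1)) := by
    rw [Nat.cast_sub (by omega), Nat.cast_sub (by omega)]
    push_cast
    linear_combination h0
  have e2 : centralTerm (ZMod p) (n - 1 - i) = centralTerm (ZMod p) (i + 1) := by
    rw [centralTerm_eq_choose_sq hpn (by omega) _ (by omega),
      centralTerm_eq_choose_sq hpn (by omega) _ (by omega), show n - 1 - i = n - (i + 1) by omega,
      Nat.choose_symm (by omega)]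
  rw [e, e2]
  have h1 : (i + 1 : ZMod p) ≠ 0 := zmod_natCast_add_one_ne_zero (by omega)
  have h3 : centralTerm (ZMod p) (i + 1) ≠ 0 := by
    rw [centralTerm]
    refine prod_ne_zero_iff.2 fun j hj => pow_ne_zero _ (div_ne_zero ?_ ?_)
    · rw [mem_range] at hj
      exact natCast_two_mul_add_one_ne_zero (zmod_natCast_ne_zero (p := p)) (by omega)
    · rw [mem_range] at hj
      rw [show (2 * j + 2 : ZMod p) = 2 * (j + 1) by ring]
      exact mul_ne_zero h2 (zmod_natCast_add_one_ne_zero (by omega))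
  field_simp
  ring

theorem not_dvd_centralBinom {k : ℕ} (hk : 2 * k < p) : ¬ p ∣ (2 * k).choose k := by
  intro h
  have h1 := Nat.choose_mul_factorial_mul_factorial (show k ≤ 2 * k by omega)
  have h2 : p ∣ (2 * k).factorial := h1 ▸ dvd_mul_of_dvd_left (dvd_mul_of_dvd_left h _) _
  have := (hp.out.dvd_factorial).1 h2
  omega

/-- The sum of the terms `16^k / ((2k+1)^3 C(2k,k)^2)` over `k < n`. -/
def inverseCentralSum (n : ℕ) : ℚ :=
  ∑ k ∈ range n, (16 : ℚ) ^ k / ((2 * (k : ℚ) + 1) ^ 3 * ((2 * k).choose k : ℚ) ^ 2)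

theorem inverseCentralSum_mem_and_cast {n : ℕ} (hpn : p = 2 * n + 1) (hn : 0 < n) :
    inverseCentralSum n ∈ pIntegralRat p ∧ (inverseCentralSum n : ZMod p) =
      ∑ k ∈ range n, 1 / ((2 * (k : ZMod p) + 1) ^ 3 * centralTerm (ZMod p) k) := by
  have h2 : (2 : ZMod p) ≠ 0 := zmod_two_ne_zero (by omega)
  have hd : ∀ k ∈ range n, ¬ p ∣ (2 * k + 1) ^ 3 * (2 * k).choose k ^ 2 := by
    intro k hk
    rw [mem_range] at hk
    rw [hp.out.dvd_mul, not_or]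
    exact ⟨fun h => Nat.not_dvd_of_pos_of_lt (by omega) (by omega) (hp.out.dvd_of_dvd_pow h),
      fun h => not_dvd_centralBinom (by omega) (hp.out.dvd_of_dvd_pow h)⟩
  have e : inverseCentralSum n = ∑ k ∈ range n,
      ((16 ^ k : ℕ) : ℚ) / (((2 * k + 1) ^ 3 * (2 * k).choose k ^ 2 : ℕ) : ℚ) := by
    refine sum_congr rfl fun k _ => ?_
    push_cast
    rfl
  have hmem := fun k hk => div_natCast_mem (natCast_mem (pIntegralRat p) (16 ^ k)) (hd k hk)
  rw [e]
  refine ⟨sum_mem hmem, ?_⟩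
  rw [zmodCast_sum _ _ hmem]
  refine sum_congr rfl fun k hk => ?_
  rw [zmodCast_div_natCast (natCast_mem _ _) (hd k hk), Rat.cast_natCast]
  rw [mem_range] at hk
  push_cast
  rw [← centralTerm_mul_pow (zmod_natCast_ne_zero (p := p)) h2 k (by omega)]
  have h16 : (16 : ZMod p) ^ k ≠ 0 := by
    rw [show (16 : ZMod p) = 2 ^ 4 by norm_num]
    exact pow_ne_zero _ (pow_ne_zero _ h2)
  rw [← mul_assoc, div_mul_cancel_right₀ h16, one_div]

theorem dvd_centralBinom {k : ℕ} (h1 : p ≤ 2 * k) (h2 : k < p) : p ∣ (2 * k).choose k := by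
  have := hp.out.dvd_choose_add h2 h2 (by omega)
  rwa [← two_mul] at this

/-- The recursion (k+1)C(2k+2,k+1) = 2(2k+1)C(2k,k), run upwards at j and downwards at p-1-j, keeps
the product constant. -/
theorem centralBinom_reflect {n : ℕ} (hpn : p = 2 * n + 1) (hn : 0 < n) (j : ℕ) (hj : j < n) :
    (((p - 1 - j).centralBinom / p : ℕ) : ZMod p) * ((2 * j + 1) * (j.centralBinom : ZMod p)) =
      -1 := by
  have h2 : (2 : ZMod p) ≠ 0 := zmod_two_ne_zero (by omega)
  have hdvd : ∀ i, i < n → p ∣ (p - 1 - i).centralBinom := fun i hi =>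
    dvd_centralBinom (by omega) (by omega)
  induction j with
  | zero =>
    obtain ⟨c, hc⟩ := hdvd 0 hj
    rw [hc, Nat.mul_div_cancel_left _ hp.out.pos]
    have h := Nat.succ_mul_centralBinom_succ (p - 1)
    rw [Nat.sub_zero] at hc
    rw [Nat.sub_add_cancel hp.out.one_le, hc, mul_left_comm] at h
    have h3 := congrArg (Nat.cast : ℕ → ZMod p) (Nat.eq_of_mul_eq_mul_left hp.out.pos h)
    -- Lucas: C(2p,p) ≡ C(0,0)·C(2,1).
    have h4 : (p.centralBinom : ZMod p) = 2 := by
      have := Choose.choose_modEq_choose_mod_mul_choose_div_nat (n := 2 * p) (k := p) (p := p)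
      rw [Nat.mul_mod_left, Nat.mod_self, Nat.mul_div_cancel _ hp.out.pos,
        Nat.div_self hp.out.pos] at this
      exact_mod_cast (ZMod.natCast_eq_natCast_iff _ _ _).2 this
    rw [h4] at h3
    push_cast at h3
    rw [zmod_natCast_prime_sub_one] at h3
    refine mul_left_cancel₀ h2 ?_
    simp
    linear_combination h3
  | succ j ih =>
    have ih := ih (by omega)
    obtain ⟨c, hc⟩ := hdvd j (by omega)
    obtain ⟨d, hd⟩ := hdvd (j + 1) hj
    rw [hc, Nat.mul_div_cancel_left _ hp.out.pos] at ih
    rw [hd, Nat.mul_div_cancel_left _ hp.out.pos]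
    have h := Nat.succ_mul_centralBinom_succ (p - 1 - (j + 1))
    rw [show p - 1 - (j + 1) + 1 = p - 1 - j by omega, hc, hd, mul_left_comm,
      mul_left_comm _ p] at h
    have h3 := congrArg (Nat.cast : ℕ → ZMod p) (Nat.eq_of_mul_eq_mul_left hp.out.pos h)
    have h4 := congrArg (Nat.cast : ℕ → ZMod p) (Nat.succ_mul_centralBinom_succ j)
    rw [Nat.cast_mul, Nat.cast_mul, Nat.cast_mul, Nat.cast_add, Nat.cast_mul,
      Nat.cast_sub (show j ≤ p - 1 by omega), Nat.cast_sub (show j + 1 ≤ p - 1 by omega),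
      zmod_natCast_prime_sub_one] at h3
    push_cast at h3 h4 ⊢
    have h1 : (j + 1 : ZMod p) ≠ 0 := zmod_natCast_add_one_ne_zero (by omega)
    refine mul_left_cancel₀ (mul_ne_zero h2 h1) ?_
    linear_combination 2 * d * (2 * (j + 1) + 1) * h4 +
      2 * (2 * j + 1) * j.centralBinom * h3 + 2 * (j + 1) * ih

theorem tail_sum_eq {n : ℕ} (hpn : p = 2 * n + 1) (hn : 0 < n) :
    1 / (p : ℚ) ^ 2 * ∑ k ∈ Icc ((p + 1) / 2) (p - 1),
      (Nat.choose (2 * k) k : ℚ) ^ 2 / ((2 * (k : ℚ) + 1) * 16 ^ k) =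
    ∑ j ∈ range n, (((p - 1 - j).centralBinom / p : ℕ) : ℚ) ^ 2 /
      ((2 * ((p - 1 - j : ℕ) : ℚ) + 1) * 16 ^ (p - 1 - j)) := by
  rw [mul_sum]
  refine sum_nbij' (fun k => p - 1 - k) (fun j => p - 1 - j) ?_ ?_ ?_ ?_ ?_
  · intro k hk
    rw [mem_Icc] at hk
    rw [mem_range]
    omega
  · intro j hj
    rw [mem_range] at hj
    rw [mem_Icc]
    omega
  · intro k hk
    rw [mem_Icc] at hk
    omega
  · intro j hj
    rw [mem_range] at hj
    omega
  · intro k hk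
    rw [mem_Icc] at hk
    rw [show p - 1 - (p - 1 - k) = k by omega,
      Nat.cast_div (show p ∣ k.centralBinom from dvd_centralBinom (by omega) (by omega))
        (by exact_mod_cast hp.out.ne_zero), Nat.centralBinom]
    ring

theorem tail_sum_mem_and_cast {n : ℕ} (hpn : p = 2 * n + 1) (hn : 0 < n) :
    (∑ j ∈ range n, (((p - 1 - j).centralBinom / p : ℕ) : ℚ) ^ 2 /
      ((2 * ((p - 1 - j : ℕ) : ℚ) + 1) * 16 ^ (p - 1 - j)) ∈ pIntegralRat p) ∧
    ((∑ j ∈ range n, (((p - 1 - j).centralBinom / p : ℕ) : ℚ) ^ 2 /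
      ((2 * ((p - 1 - j : ℕ) : ℚ) + 1) * 16 ^ (p - 1 - j)) : ℚ) : ZMod p) =
      -∑ k ∈ range n, 1 / ((2 * (k : ZMod p) + 1) ^ 3 * centralTerm (ZMod p) k) := by
  have h2 : (2 : ZMod p) ≠ 0 := zmod_two_ne_zero (by omega)
  have h16 : (16 : ZMod p) ≠ 0 := by
    rw [show (16 : ZMod p) = 2 ^ 4 by norm_num]
    exact pow_ne_zero _ h2
  have hcast : ∀ j ∈ range n, (((2 * (p - 1 - j) + 1) * 16 ^ (p - 1 - j) : ℕ) : ZMod p) =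
      -(2 * j + 1) / 16 ^ j := by
    intro j hj
    rw [mem_range] at hj
    rw [eq_div_iff (pow_ne_zero _ h16), Nat.cast_mul, Nat.cast_pow, mul_assoc]
    have : ((16 : ℕ) : ZMod p) ^ (p - 1 - j) * 16 ^ j = 1 := by
      rw [Nat.cast_ofNat, ← pow_add, Nat.sub_add_cancel (by omega),
        ZMod.pow_card_sub_one_eq_one h16]
    rw [this, mul_one]
    push_cast [Nat.cast_sub (show j ≤ p - 1 by omega)]
    rw [zmod_natCast_prime_sub_one]
    ring
  have hodd : ∀ j ∈ range n, (2 * j + 1 : ZMod p) ≠ 0 := fun j hj =>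
    natCast_two_mul_add_one_ne_zero (zmod_natCast_ne_zero (p := p))
      (by have := mem_range.1 hj; omega)
  have hd : ∀ j ∈ range n, ¬ p ∣ (2 * (p - 1 - j) + 1) * 16 ^ (p - 1 - j) := by
    intro j hj
    rw [← ZMod.natCast_eq_zero_iff, hcast j hj]
    exact div_ne_zero (neg_ne_zero.2 (hodd j hj)) (pow_ne_zero _ h16)
  have e : ∑ j ∈ range n, (((p - 1 - j).centralBinom / p : ℕ) : ℚ) ^ 2 /
      ((2 * ((p - 1 - j : ℕ) : ℚ) + 1) * 16 ^ (p - 1 - j)) =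
      ∑ j ∈ range n, ((((p - 1 - j).centralBinom / p) ^ 2 : ℕ) : ℚ) /
        (((2 * (p - 1 - j) + 1) * 16 ^ (p - 1 - j) : ℕ) : ℚ) := by
    refine sum_congr rfl fun j _ => ?_
    simp only [Nat.cast_mul, Nat.cast_add, Nat.cast_pow, Nat.cast_ofNat, Nat.cast_one]
  have hmem := fun j hj => div_natCast_mem
    (natCast_mem (pIntegralRat p) (((p - 1 - j).centralBinom / p) ^ 2)) (hd j hj)
  rw [e]
  refine ⟨sum_mem hmem, ?_⟩
  rw [zmodCast_sum _ _ hmem, ← sum_neg_distrib]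
  refine sum_congr rfl fun j hj => ?_
  rw [zmodCast_div_natCast (natCast_mem _ _) (hd j hj), Rat.cast_natCast, hcast j hj]
  have h1 := hodd j hj
  rw [mem_range] at hj
  have h3 := centralBinom_reflect hpn hn j hj
  have h4 := centralTerm_mul_pow (zmod_natCast_ne_zero (p := p)) h2 j (by omega)
  have hC : ((2 * j).choose j : ZMod p) ≠ 0 := by
    rw [Ne, ZMod.natCast_eq_zero_iff]
    exact not_dvd_centralBinom (by omega)
  rw [Nat.centralBinom] at h3
  have e3 : centralTerm (ZMod p) j = ((2 * j).choose j : ZMod p) ^ 2 / 16 ^ j := by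
    rw [eq_div_iff (pow_ne_zero _ h16), h4]
  have e5 : (((p - 1 - j).centralBinom / p : ℕ) : ZMod p) =
      -1 / ((2 * j + 1) * ((2 * j).choose j : ZMod p)) := by
    rw [eq_div_iff (mul_ne_zero h1 hC)]
    exact h3
  rw [e3, Nat.cast_pow, e5]
  field_simp

end Central

/-- First-order expansion with the remainder kept in R; it is applied with t = p² and R the
p-integral rationals. -/
theorem exists_prod_one_sub_mul_eq {A : Type*} [CommRing A] (R : Subring A) {t : A} (ht : t ∈ R)
    (x : ℕ → A) (k : ℕ) (hx : ∀ j ∈ range k, x j ∈ R) :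
    ∃ e ∈ R, ∏ j ∈ range k, (1 - t * x j) = 1 - t * ∑ j ∈ range k, x j + t ^ 2 * e := by
  induction k with
  | zero => exact ⟨0, zero_mem _, by simp⟩
  | succ k ih =>
    obtain ⟨e, he, h⟩ := ih fun j hj => hx j (mem_range.2 ((mem_range.1 hj).trans k.lt_succ_self))
    have hk := hx k (self_mem_range_succ k)
    have hs : ∑ j ∈ range k, x j ∈ R :=
      sum_mem fun j hj => hx j (mem_range.2 ((mem_range.1 hj).trans k.lt_succ_self))
    refine ⟨e + x k * ∑ j ∈ range k, x j - t * e * x k,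
      sub_mem (add_mem he (mul_mem hk hs)) (mul_mem (mul_mem ht he) hk), ?_⟩
    rw [prod_range_succ, sum_range_succ, h]
    ring

/-! ### A calculus of residues for p-integral rationals. -/

section Reduction

variable {p : ℕ} [hp : Fact p.Prime]

/-- The rational number `q` is `p`-integral with residue `x`. -/
def ReducesTo (q : ℚ) (x : ZMod p) : Prop :=
  q ∈ pIntegralRat p ∧ (q : ZMod p) = x

namespace ReducesTo

variable {a b : ℚ} {x y : ZMod p}

theorem natCast (m : ℕ) : ReducesTo (m : ℚ) (m : ZMod p) :=
  ⟨natCast_mem _ _, Rat.cast_natCast m⟩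

theorem ofNat (m : ℕ) [m.AtLeastTwo] : ReducesTo (OfNat.ofNat m : ℚ) (OfNat.ofNat m : ZMod p) := by
  simpa using natCast (p := p) (OfNat.ofNat m)

theorem one : ReducesTo (1 : ℚ) (1 : ZMod p) := by
  simpa using natCast (p := p) 1

theorem prime : ReducesTo (p : ℚ) (0 : ZMod p) := by
  simpa using natCast (p := p) p

theorem add (ha : ReducesTo a x) (hb : ReducesTo b y) : ReducesTo (a + b) (x + y) :=
  ⟨add_mem ha.1 hb.1, by rw [zmodCast_add ha.1 hb.1, ha.2, hb.2]⟩

theorem sub (ha : ReducesTo a x) (hb : ReducesTo b y) : ReducesTo (a - b) (x - y) :=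
  ⟨sub_mem ha.1 hb.1, by rw [zmodCast_sub ha.1 hb.1, ha.2, hb.2]⟩

theorem mul (ha : ReducesTo a x) (hb : ReducesTo b y) : ReducesTo (a * b) (x * y) :=
  ⟨mul_mem ha.1 hb.1, by rw [zmodCast_mul ha.1 hb.1, ha.2, hb.2]⟩

theorem pow (ha : ReducesTo a x) (m : ℕ) : ReducesTo (a ^ m) (x ^ m) :=
  ⟨pow_mem ha.1 m, by rw [zmodCast_pow ha.1, ha.2]⟩

theorem inv (ha : ReducesTo a x) (hx : x ≠ 0) : ReducesTo a⁻¹ x⁻¹ := by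
  have ha0 : a ≠ 0 := by
    rintro rfl
    exact hx (by rw [← ha.2, Rat.cast_zero])
  have hmem : a⁻¹ ∈ pIntegralRat p := by
    have hnum : ¬ p ∣ a.num.natAbs := by
      rw [← Int.natCast_dvd, ← ZMod.intCast_zmod_eq_zero_iff_dvd]
      intro h
      apply hx
      rw [← ha.2, Rat.cast_def, h, zero_div]
    have e : a⁻¹ = (a.den : ℚ) / a.num := by
      conv_lhs => rw [← Rat.num_div_den a, inv_div]
    rw [e]
    rcases Int.natAbs_eq a.num with h | h
    · rw [h, Int.cast_natCast]
      exact div_natCast_mem (natCast_mem _ _) hnum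
    · rw [h, Int.cast_neg, Int.cast_natCast, div_neg]
      exact neg_mem (div_natCast_mem (natCast_mem _ _) hnum)
  refine ⟨hmem, ?_⟩
  have h := zmodCast_mul ha.1 hmem
  rw [mul_inv_cancel₀ ha0, Rat.cast_one, ha.2] at h
  exact eq_inv_of_mul_eq_one_right h.symm

theorem div (ha : ReducesTo a x) (hb : ReducesTo b y) (hy : y ≠ 0) : ReducesTo (a / b) (x / y) := by
  rw [div_eq_mul_inv, div_eq_mul_inv]
  exact ha.mul (hb.inv hy)

theorem sum {s : Finset ℕ} {f : ℕ → ℚ} {g : ℕ → ZMod p} (h : ∀ i ∈ s, ReducesTo (f i) (g i)) :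
    ReducesTo (∑ i ∈ s, f i) (∑ i ∈ s, g i) :=
  ⟨sum_mem fun i hi => (h i hi).1, by
    rw [zmodCast_sum _ _ fun i hi => (h i hi).1]
    exact sum_congr rfl fun i hi => (h i hi).2⟩

theorem prod {k : ℕ} {f : ℕ → ℚ} {g : ℕ → ZMod p} (h : ∀ i ∈ range k, ReducesTo (f i) (g i)) :
    ReducesTo (∏ i ∈ range k, f i) (∏ i ∈ range k, g i) := by
  induction k with
  | zero => simpa using one
  | succ k ih =>
    rw [prod_range_succ, prod_range_succ]
    exact (ih fun i hi => h i (mem_range.2 ((mem_range.1 hi).trans k.lt_succ_self))).mul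
      (h k (self_mem_range_succ k))

end ReducesTo

theorem reducesTo_centralTerm {n : ℕ} (hpn : p = 2 * n + 1) {k : ℕ} (hk : k ≤ n) :
    ReducesTo (centralTerm ℚ k) (centralTerm (ZMod p) k) := by
  refine ReducesTo.prod fun j hj => ?_
  rw [mem_range] at hj
  have h2 : (2 : ZMod p) ≠ 0 := zmod_two_ne_zero (by omega)
  have hj0 : (2 * j + 2 : ZMod p) ≠ 0 := by
    rw [show (2 * j + 2 : ZMod p) = 2 * (j + 1) by ring]
    exact mul_ne_zero h2 (zmod_natCast_add_one_ne_zero (by omega))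
  have h := (ReducesTo.ofNat (p := p) 2).mul (ReducesTo.natCast j)
  exact ((h.add .one).div (h.add (.ofNat 2)) hj0).pow 2

theorem fermatQuotient_two_mem (h2 : 2 < p) : fermatQuotient p 2 ∈ pIntegralRat p := by
  have h := (((ReducesTo.ofNat (p := p) 2).pow (p - 1)).sub .one)
  rw [ZMod.pow_card_sub_one_eq_one (zmod_two_ne_zero h2), sub_self] at h
  obtain ⟨c, hc, e⟩ := exists_eq_mul_of_zmodCast_eq_zero h.1 h.2
  rw [fermatQuotient, Nat.cast_ofNat, e,
    mul_div_cancel_left₀ _ (by exact_mod_cast hp.out.ne_zero)]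
  exact hc

end Reduction

/-! ### Exact rational identities for C(2n,n). -/

section CentralBinomial

theorem prod_add_div_eq_centralBinom (n : ℕ) :
    ∏ j ∈ range n, (((n : ℚ) + 1 + j) / (j + 1)) = (2 * n).choose n := by
  have h1 := Nat.ascFactorial_eq_prod_range (n + 1) n
  rw [Nat.ascFactorial_eq_factorial_mul_choose, ← two_mul] at h1
  have h2 := prod_range_add_one_eq_factorial n
  have h3 := congrArg (Nat.cast : ℕ → ℚ) h1
  have h4 := congrArg (Nat.cast : ℕ → ℚ) h2
  push_cast at h3 h4
  rw [prod_div_distrib, ← h3, h4, mul_div_cancel_left₀]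
  exact_mod_cast n.factorial_ne_zero

theorem prod_one_sub_eq {n : ℕ} :
    ∏ j ∈ range n, (1 - (2 * (n : ℚ) + 1) / (j + 1)) =
      (-1) ^ n * ((2 * n).choose n : ℚ) := by
  rw [← prod_add_div_eq_centralBinom, prod_div_distrib,
    ← prod_range_reflect (fun j : ℕ => (n : ℚ) + 1 + j), ← prod_div_distrib]
  nth_rewrite 3 [← card_range n]
  rw [← prod_const, ← prod_mul_distrib]
  refine prod_congr rfl fun j hj => ?_
  rw [mem_range] at hj
  have h0 : (j + 1 : ℚ) ≠ 0 := by positivity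
  rw [Nat.cast_sub (by omega), Nat.cast_sub (by omega)]
  field_simp
  push_cast
  ring

theorem prod_odd_sq_sub_eq {n : ℕ} :
    ∏ j ∈ range n, ((2 * (j : ℚ) + 1) ^ 2 - (2 * n + 1) ^ 2) / (2 * j + 2) ^ 2 =
      (-1) ^ n * ((2 * n).choose n : ℚ) := by
  have h1 : ∏ j ∈ range n, ((n : ℚ) - j) / (j + 1) = 1 := by
    rw [prod_div_distrib, ← prod_range_reflect (fun j : ℕ => (n : ℚ) - j), ← prod_div_distrib]
    refine prod_eq_one fun j hj => ?_
    rw [mem_range] at hj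
    have h0 : (j + 1 : ℚ) ≠ 0 := by positivity
    rw [Nat.cast_sub (by omega), Nat.cast_sub (by omega)]
    field_simp
    push_cast
    ring
  have h2 : ∏ _j ∈ range n, (-1 : ℚ) = (-1) ^ n := by rw [prod_const, card_range]
  calc _ = (∏ j ∈ range n, ((n : ℚ) - j) / (j + 1)) * ((∏ _j ∈ range n, (-1 : ℚ)) *
        ∏ j ∈ range n, (((n : ℚ) + 1 + j) / (j + 1))) := by
        rw [← prod_mul_distrib, ← prod_mul_distrib]
        refine prod_congr rfl fun j _ => ?_
        have h0 : (j + 1 : ℚ) ≠ 0 := by positivity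
        rw [show (2 * j + 2 : ℚ) = 2 * (j + 1) by ring]
        field_simp
        ring
    _ = _ := by rw [h1, h2, one_mul, prod_add_div_eq_centralBinom]

theorem prod_one_sub_half_sq_eq {n : ℕ} :
    16 ^ n * ∏ j ∈ range n, (1 - (2 * (n : ℚ) + 1) / (2 * (j + 1))) ^ 2 =
      ((2 * n).choose n : ℚ) ^ 2 := by
  rw [← centralTerm_mul_pow (N := n + 1) (fun j hj _ => by positivity) two_ne_zero n n.lt_succ_self,
    mul_comm, centralTerm]
  congr 1
  simp_rw [div_pow]
  rw [prod_div_distrib, ← prod_range_reflect (fun j : ℕ => (2 * (j : ℚ) + 1) ^ 2),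
    ← prod_div_distrib]
  refine prod_congr rfl fun j hj => ?_
  rw [mem_range] at hj
  have h0 : (j + 1 : ℚ) ≠ 0 := by positivity
  rw [show (2 * j + 2 : ℚ) = 2 * (j + 1) by ring, Nat.cast_sub (by omega), Nat.cast_sub (by omega)]
  field_simp
  push_cast
  ring

/-- An exact form of the Morley–Carlitz congruence for the central binomial coefficient. -/
theorem neg_one_pow_mul_centralBinom_eq {n : ℕ} :
    (-1) ^ n * ((2 * n).choose n : ℚ) = 16 ^ n * ∏ j ∈ range n,
      (1 - (2 * (n : ℚ) + 1) ^ 2 * (1 / (4 * ((j + 1) * (2 * n + 1 - (j + 1)))))) := by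
  have hC : (-1) ^ n * ((2 * n).choose n : ℚ) ≠ 0 := by
    refine mul_ne_zero (pow_ne_zero _ (by norm_num)) ?_
    exact_mod_cast (Nat.choose_pos (by omega)).ne'
  refine mul_left_cancel₀ hC ?_
  have e : (-1) ^ n * ((2 * n).choose n : ℚ) * ((-1) ^ n * ((2 * n).choose n : ℚ)) =
      ((2 * n).choose n : ℚ) ^ 2 := by
    rw [mul_mul_mul_comm, ← mul_pow]
    norm_num
    ring
  -- With p = 2n+1 and x running over 1, …, n, this divides C(2n,n)² = 16^n ∏(1 - p/(2x))² by (-1)^n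
  -- C(2n,n) = ∏(1 - p/x), factor by factor.
  rw [e, ← prod_one_sub_half_sq_eq, ← prod_one_sub_eq, mul_left_comm, ← prod_mul_distrib]
  congr 1
  refine prod_congr rfl fun j hj => ?_
  rw [mem_range] at hj
  have h0 : (j + 1 : ℚ) ≠ 0 := by positivity
  have h1 : (2 * n + 1 - (j + 1) : ℚ) ≠ 0 := by
    have : (j : ℚ) < n := by exact_mod_cast hj
    have : (0 : ℚ) ≤ j := by positivity
    linarith
  field_simp
  ring

/-- The summand is invariant under x ↦ 2n+1-x, so the sum over 1, …, 2n is twice the sum over its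
lower half and also twice the sum over even x. -/
theorem sum_one_div_mul_sub_eq_double {n : ℕ} :
    ∑ j ∈ range n, 1 / (((j : ℚ) + 1) * (2 * n + 1 - (j + 1))) =
      ∑ j ∈ range n, 1 / ((2 * ((j : ℚ) + 1)) * (2 * n + 1 - 2 * (j + 1))) := by
  have h1 := sum_range_two_mul_reflect
    (fun i : ℕ => 1 / (((i : ℚ) + 1) * (2 * n + 1 - (i + 1)))) n
  rw [sum_range_two_mul_parity, ← sum_range_reflect _ n] at h1
  have h2 : ∑ j ∈ range n, 1 / ((((2 * n - 1 - j : ℕ) : ℚ) + 1) *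
      (2 * n + 1 - (((2 * n - 1 - j : ℕ) : ℚ) + 1))) =
      ∑ j ∈ range n, 1 / (((j : ℚ) + 1) * (2 * n + 1 - (j + 1))) := by
    refine sum_congr rfl fun j hj => ?_
    rw [mem_range] at hj
    rw [Nat.cast_sub (by omega), Nat.cast_sub (by omega)]
    congr 1
    push_cast
    ring
  have h3 : ∑ j ∈ range n, 1 / ((((2 * (n - 1 - j) : ℕ) : ℚ) + 1) *
      (2 * n + 1 - (((2 * (n - 1 - j) : ℕ) : ℚ) + 1))) =
      ∑ j ∈ range n, 1 / ((2 * ((j : ℚ) + 1)) * (2 * n + 1 - 2 * (j + 1))) := by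
    refine sum_congr rfl fun j hj => ?_
    rw [mem_range] at hj
    rw [Nat.cast_mul, Nat.cast_sub (by omega), Nat.cast_sub (by omega)]
    congr 1
    push_cast
    ring
  have h4 : ∑ j ∈ range n, 1 / ((((2 * j + 1 : ℕ) : ℚ) + 1) *
      (2 * n + 1 - (((2 * j + 1 : ℕ) : ℚ) + 1))) =
      ∑ j ∈ range n, 1 / ((2 * ((j : ℚ) + 1)) * (2 * n + 1 - 2 * (j + 1))) := by
    refine sum_congr rfl fun j _ => ?_
    congr 1
    push_cast
    ring
  rw [h2, h3, h4] at h1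
  linarith

/-- With P = 2n+1, 1/(x(P-x)) = 4/(2x(P-2x)) - P/(x(P-x)(P-2x)); the middle sum equals the left one,
so S = 4S - PV. This exposes an extra factor P. -/
theorem sum_one_div_mul_sub_eq {n : ℕ} :
    3 * ∑ j ∈ range n, 1 / (((j : ℚ) + 1) * (2 * n + 1 - (j + 1))) =
      (2 * n + 1) * ∑ j ∈ range n,
        1 / (((j : ℚ) + 1) * (2 * n + 1 - (j + 1)) * (2 * n + 1 - 2 * (j + 1))) := by
  have h : ∑ j ∈ range n, 1 / (((j : ℚ) + 1) * (2 * n + 1 - (j + 1))) =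
      4 * ∑ j ∈ range n, 1 / ((2 * ((j : ℚ) + 1)) * (2 * n + 1 - 2 * (j + 1))) -
      (2 * n + 1) * ∑ j ∈ range n,
        1 / (((j : ℚ) + 1) * (2 * n + 1 - (j + 1)) * (2 * n + 1 - 2 * (j + 1))) := by
    rw [mul_sum, mul_sum, ← sum_sub_distrib]
    refine sum_congr rfl fun j hj => ?_
    rw [mem_range] at hj
    have hj' : (j : ℚ) + 1 ≤ n := by exact_mod_cast hj
    have hj0 : (0 : ℚ) ≤ j := by positivity
    have h0 : (j + 1 : ℚ) ≠ 0 := by positivity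
    have h1 : (2 * n + 1 - (j + 1) : ℚ) ≠ 0 := by linarith
    have h2 : (2 * n + 1 - 2 * (j + 1) : ℚ) ≠ 0 := by linarith
    generalize (2 * n + 1 : ℚ) = P at h1 h2 ⊢
    generalize (j + 1 : ℚ) = x at h0 h1 h2 ⊢
    obtain ⟨w, rfl⟩ : ∃ w, P = w + 2 * x := ⟨P - 2 * x, by ring⟩
    rw [show w + 2 * x - x = w + x by ring] at h1 ⊢
    rw [add_sub_cancel_right] at h2 ⊢
    field_simp
    ring
  rw [← sum_one_div_mul_sub_eq_double] at h
  linarith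

end CentralBinomial

/-! ### The congruence modulo p³. -/

section Main

variable {p : ℕ} [hp : Fact p.Prime]

theorem centralBinom_modEq {n : ℕ} (hpn : p = 2 * n + 1) (hn : 1 < n) :
    ∃ V e : ℚ, ReducesTo V (1 / 2 * harmonicSum (ZMod p) 3 n) ∧ e ∈ pIntegralRat p ∧
      (-1) ^ n * ((2 * n).choose n : ℚ) =
        (1 + p * fermatQuotient p 2) ^ 2 * (1 - p ^ 3 * (V / 12) + p ^ 4 * e) := by
  have hpq : (p : ℚ) = 2 * n + 1 := by rw [hpn]; push_cast; ring
  have h2 : (2 : ZMod p) ≠ 0 := zmod_two_ne_zero (by omega)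
  have hp0 : (p : ℚ) ≠ 0 := by exact_mod_cast hp.out.ne_zero
  have hx : ∀ j ∈ range n, 1 / (4 * (((j : ℚ) + 1) * (p - (j + 1)))) ∈ pIntegralRat p := by
    intro j hj
    rw [mem_range] at hj
    have h0 : (j + 1 : ZMod p) ≠ 0 := zmod_natCast_add_one_ne_zero (by omega)
    have hj1 := (ReducesTo.natCast (p := p) j).add .one
    refine (ReducesTo.div .one ((ReducesTo.ofNat 4).mul (hj1.mul (ReducesTo.prime.sub hj1))) ?_).1
    refine mul_ne_zero ?_ (mul_ne_zero h0 (by rwa [zero_sub, neg_ne_zero]))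
    rw [show (4 : ZMod p) = 2 * 2 by norm_num]
    exact mul_ne_zero h2 h2
  obtain ⟨e, he, h⟩ := exists_prod_one_sub_mul_eq (pIntegralRat p)
    (pow_mem (natCast_mem _ p) 2 : (p : ℚ) ^ 2 ∈ pIntegralRat p) _ n hx
  refine ⟨∑ j ∈ range n, 1 / (((j : ℚ) + 1) * (p - (j + 1)) * (p - 2 * (j + 1))), e, ?_, he, ?_⟩
  · have hV : 1 / 2 * harmonicSum (ZMod p) 3 n = ∑ j ∈ range n,
        1 / (((j : ZMod p) + 1) * (0 - (j + 1)) * (0 - 2 * (j + 1))) := by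
      rw [harmonicSum, mul_sum]
      refine sum_congr rfl fun j hj => ?_
      rw [mem_range] at hj
      have h0 : (j + 1 : ZMod p) ≠ 0 := zmod_natCast_add_one_ne_zero (by omega)
      rw [show (0 - ((j : ZMod p) + 1)) = -(j + 1) by ring,
        show (0 - 2 * ((j : ZMod p) + 1)) = -(2 * (j + 1)) by ring]
      field_simp
    rw [hV]
    refine ReducesTo.sum fun j hj => ?_
    rw [mem_range] at hj
    have h0 : (j + 1 : ZMod p) ≠ 0 := zmod_natCast_add_one_ne_zero (by omega)
    have hj1 := (ReducesTo.natCast (p := p) j).add .one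
    refine ReducesTo.div .one ((hj1.mul (ReducesTo.prime.sub hj1)).mul
      (ReducesTo.prime.sub ((ReducesTo.ofNat 2).mul hj1))) ?_
    rw [zero_sub, zero_sub]
    exact mul_ne_zero (mul_ne_zero h0 (neg_ne_zero.2 h0)) (neg_ne_zero.2 (mul_ne_zero h2 h0))
  -- 1 + p q_p(2) = 2^(2n), whose square is 16^n.
  · have hq : (1 + p * fermatQuotient p 2) ^ 2 = 16 ^ n := by
      rw [fermatQuotient, mul_div_cancel₀ _ hp0, show p - 1 = 2 * n by omega]
      rw [show (16 : ℚ) = (2 ^ 2) ^ 2 by norm_num, ← pow_mul, ← pow_mul]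
      push_cast
      ring
    have hW := sum_one_div_mul_sub_eq (n := n)
    rw [← hpq] at hW
    have hx4 : ∑ j ∈ range n, 1 / (4 * (((j : ℚ) + 1) * (p - (j + 1)))) =
        1 / 4 * ∑ j ∈ range n, 1 / (((j : ℚ) + 1) * (p - (j + 1))) := by
      rw [mul_sum]
      refine sum_congr rfl fun j _ => ?_
      rw [one_div_mul_one_div]
    rw [neg_one_pow_mul_centralBinom_eq, hq, ← hpq, h, hx4]
    linear_combination -(16 ^ n * (p : ℚ) ^ 2 / 12) * hW

theorem sum_centralTerm_modEq {n : ℕ} (hpn : p = 2 * n + 1) (hn : 1 < n) :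
    ∃ Z E : ℚ, ReducesTo Z (-(1 / 4) * harmonicSum (ZMod p) 3 n) ∧ E ∈ pIntegralRat p ∧
      ∑ k ∈ range n, centralTerm ℚ k / (2 * k + 1) =
        (1 - (-1) ^ n * ((2 * n).choose n : ℚ)) / p + p ^ 2 * Z - p ^ 4 * E := by
  have hpq : (p : ℚ) = 2 * n + 1 := by rw [hpn]; push_cast; ring
  have hp0 : (p : ℚ) ≠ 0 := by exact_mod_cast hp.out.ne_zero
  have hodd : ∀ j, j < n → (2 * j + 1 : ZMod p) ≠ 0 := fun j hj =>
    natCast_two_mul_add_one_ne_zero (zmod_natCast_ne_zero (p := p)) (by omega)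
  have hj1 : ∀ j : ℕ, ReducesTo (2 * (j : ℚ) + 1) (2 * j + 1 : ZMod p) := fun j =>
    ((ReducesTo.ofNat 2).mul (ReducesTo.natCast j)).add .one
  have hb : ∀ j, j < n → ReducesTo (1 / (2 * (j : ℚ) + 1) ^ 2) (1 / (2 * j + 1 : ZMod p) ^ 2) :=
    fun j hj => ReducesTo.div .one ((hj1 j).pow 2) (pow_ne_zero _ (hodd j hj))
  have hexp : ∀ k : ℕ, ∃ e : ℚ, k < n → e ∈ pIntegralRat p ∧
      ∏ j ∈ range k, (1 - (p : ℚ) ^ 2 * (1 / (2 * (j : ℚ) + 1) ^ 2)) =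
        1 - p ^ 2 * ∑ j ∈ range k, 1 / (2 * (j : ℚ) + 1) ^ 2 + (p ^ 2) ^ 2 * e := by
    intro k
    by_cases hk : k < n
    · obtain ⟨e, he, h⟩ := exists_prod_one_sub_mul_eq (pIntegralRat p)
        (pow_mem (natCast_mem _ p) 2 : (p : ℚ) ^ 2 ∈ pIntegralRat p)
        (fun j : ℕ => 1 / (2 * (j : ℚ) + 1) ^ 2) k
        (fun j hj => (hb j ((mem_range.1 hj).trans hk)).1)
      exact ⟨e, fun _ => ⟨he, h⟩⟩
    -- A dummy value, so that the remainder can be chosen as a function of every k.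
    · exact ⟨0, fun h => absurd h hk⟩
  choose e he using hexp
  have hck : ∀ k ∈ range n, ReducesTo (centralTerm ℚ k / (2 * k + 1))
      (centralTerm (ZMod p) k / (2 * (k : ZMod p) + 1)) := fun k hk =>
    (reducesTo_centralTerm hpn (mem_range.1 hk).le).div (hj1 k) (hodd k (mem_range.1 hk))
  refine ⟨∑ k ∈ range n, centralTerm ℚ k / (2 * k + 1) *
      ∑ j ∈ range k, 1 / (2 * (j : ℚ) + 1) ^ 2,
    ∑ k ∈ range n, centralTerm ℚ k / (2 * k + 1) * e k, ?_, ?_, ?_⟩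
  · rw [← sum_centralTerm_odd_sq hpn hn]
    refine ReducesTo.sum fun k hk => (hck k hk).mul (ReducesTo.sum fun j hj => hb j ?_)
    exact (mem_range.1 hj).trans (mem_range.1 hk)
  · exact sum_mem fun k hk => mul_mem (hck k hk).1 (he k (mem_range.1 hk)).1
  -- At m = n the node 2m+1 is p itself; in characteristic zero any N above it will do.
  · have h1 := sum_prod_odd_sq_sub (K := ℚ) (N := 2 * n + 2) (fun j hj _ => by positivity)
      two_ne_zero n (by omega)
    rw [sum_range_succ, prod_odd_sq_sub_eq, ← hpq] at h1
    have h2 : ∀ k ∈ range n,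
        (∏ j ∈ range k, ((2 * (j : ℚ) + 1) ^ 2 - (p : ℚ) ^ 2) / (2 * j + 2) ^ 2) / (2 * k + 1) =
        centralTerm ℚ k / (2 * k + 1) - p ^ 2 * (centralTerm ℚ k / (2 * k + 1) *
          ∑ j ∈ range k, 1 / (2 * (j : ℚ) + 1) ^ 2) +
          p ^ 4 * (centralTerm ℚ k / (2 * k + 1) * e k) := by
      intro k hk
      have h3 : ∏ j ∈ range k, ((2 * (j : ℚ) + 1) ^ 2 - (p : ℚ) ^ 2) / (2 * j + 2) ^ 2 =
          centralTerm ℚ k * ∏ j ∈ range k, (1 - (p : ℚ) ^ 2 * (1 / (2 * (j : ℚ) + 1) ^ 2)) := by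
        rw [centralTerm, ← prod_mul_distrib]
        refine prod_congr rfl fun j _ => ?_
        have h4 : (2 * j + 1 : ℚ) ≠ 0 := by positivity
        have h5 : (2 * j + 2 : ℚ) ≠ 0 := by positivity
        field_simp
      rw [h3, (he k (mem_range.1 hk)).2]
      ring
    rw [sum_congr rfl h2, sum_add_distrib, sum_sub_distrib, ← mul_sum, ← mul_sum] at h1
    rw [sub_div]
    linear_combination h1

theorem sum_centralTerm_ratModEq {n : ℕ} (hpn : p = 2 * n + 1) (hn : 1 < n) :
    RatModEq p 3 (∑ k ∈ range n, centralTerm ℚ k / (2 * k + 1))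
      (-2 * fermatQuotient p 2 - (p : ℚ) * fermatQuotient p 2 ^ 2 +
        5 / 12 * (p : ℚ) ^ 2 * bernoulli (p - 3)) := by
  have hp0 : (p : ℚ) ≠ 0 := by exact_mod_cast hp.out.ne_zero
  have h2 : (2 : ZMod p) ≠ 0 := zmod_two_ne_zero (by omega)
  have h3 : (3 : ZMod p) ≠ 0 := by
    exact_mod_cast zmod_natCast_ne_zero (p := p) 3 (by omega) (by omega)
  have h12 : (12 : ZMod p) ≠ 0 := by
    rw [show (12 : ZMod p) = 2 * 2 * 3 by norm_num]
    exact mul_ne_zero (mul_ne_zero h2 h2) h3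
  have h4 : (4 : ZMod p) ≠ 0 := by
    rw [show (4 : ZMod p) = 2 * 2 by norm_num]
    exact mul_ne_zero h2 h2
  obtain ⟨V, e, hV, he, hL⟩ := centralBinom_modEq hpn hn
  obtain ⟨Z, E, hZ, hE, hX⟩ := sum_centralTerm_modEq hpn hn
  have hB : ReducesTo (bernoulli (p - 3)) (bernoulli (p - 3) : ZMod p) :=
    ⟨bernoulli_mem (by omega), rfl⟩
  have hV12 := hV.div (ReducesTo.ofNat 12) h12
  have hc := (hZ.add hV12).sub
    (((ReducesTo.ofNat 5).div (ReducesTo.ofNat 12) h12).mul hB)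
  -- With H_3(n) = -2B_{p-3} this is 1/2 - 1/12 = 5/12.
  have hzero : -(1 / 4) * harmonicSum (ZMod p) 3 n + 1 / 2 * harmonicSum (ZMod p) 3 n / 12 -
      5 / 12 * (bernoulli (p - 3) : ZMod p) = 0 := by
    rw [harmonicSum_three_eq_bernoulli hpn hn]
    field_simp
    ring
  have hc' := hc.2
  rw [hzero] at hc'
  obtain ⟨c, hcm, hceq⟩ := exists_eq_mul_of_zmodCast_eq_zero hc.1 hc'
  have hq := fermatQuotient_two_mem (p := p) (by omega)
  have hpm : (p : ℚ) ∈ pIntegralRat p := natCast_mem _ p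
  have h2m : (2 : ℚ) ∈ pIntegralRat p := (ReducesTo.ofNat 2).1
  set q := fermatQuotient p 2
  -- Here p·c is the error in the p² coefficient; the other terms come from (1 + pq)² = 1 + p(2q +
  -- pq²) multiplying V/12 and from the two remainders.
  refine ⟨c + (2 * q + p * q ^ 2) * (V / 12) - (1 + p * q) ^ 2 * e - p * E,
    sub_mem (sub_mem (add_mem hcm (mul_mem (add_mem (mul_mem h2m hq)
      (mul_mem hpm (pow_mem hq 2))) hV12.1)) (mul_mem (pow_mem (add_mem (one_mem _)
      (mul_mem hpm hq)) 2) he)) (mul_mem hpm hE), ?_⟩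
  have hdiv : (1 - (1 + p * q) ^ 2 * (1 - (p : ℚ) ^ 3 * (V / 12) + p ^ 4 * e)) / p =
      -2 * q - p * q ^ 2 + (1 + p * q) ^ 2 * ((p : ℚ) ^ 2 * (V / 12) - p ^ 3 * e) := by
    field_simp
    ring
  rw [hX, hL, hdiv]
  linear_combination (p : ℚ) ^ 2 * hceq

end Main

theorem theorem1p2 (p : ℕ) (hp : p.Prime) (hp3 : 3 < p) :
    (RatModEq p 1
        (1 / (p : ℚ) ^ 2 *
          ∑ k ∈ Finset.Icc ((p + 1) / 2) (p - 1),
            (Nat.choose (2 * k) k : ℚ) ^ 2 / ((2 * (k : ℚ) + 1) * 16 ^ k))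
        (-∑ k ∈ Finset.Icc 0 ((p - 3) / 2),
            (16 : ℚ) ^ k / ((2 * (k : ℚ) + 1) ^ 3 * (Nat.choose (2 * k) k : ℚ) ^ 2)) ∧
      RatModEq p 1
        (-∑ k ∈ Finset.Icc 0 ((p - 3) / 2),
            (16 : ℚ) ^ k / ((2 * (k : ℚ) + 1) ^ 3 * (Nat.choose (2 * k) k : ℚ) ^ 2))
        (-(7 / 4) * bernoulli (p - 3))) ∧
    RatModEq p 3
      (∑ k ∈ Finset.Icc 0 ((p - 3) / 2),
        (Nat.choose (2 * k) k : ℚ) ^ 2 / ((2 * (k : ℚ) + 1) * 16 ^ k))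
      (-2 * fermatQuotient p 2 - (p : ℚ) * fermatQuotient p 2 ^ 2 +
        5 / 12 * (p : ℚ) ^ 2 * bernoulli (p - 3)) := by
  have : Fact p.Prime := ⟨hp⟩
  obtain ⟨n, hpn⟩ := hp.odd_of_ne_two (by omega)
  have hn : 1 < n := by omega
  have hIcc : Icc 0 ((p - 3) / 2) = range n := by
    ext k
    rw [mem_Icc, mem_range]
    omega
  have h2 : (2 : ZMod p) ≠ 0 := zmod_two_ne_zero (by omega)
  have h4 : (4 : ZMod p) ≠ 0 := by
    rw [show (4 : ZMod p) = 2 * 2 by norm_num]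
    exact mul_ne_zero h2 h2
  rw [hIcc]
  change (RatModEq p 1 _ (-inverseCentralSum n) ∧ RatModEq p 1 (-inverseCentralSum n) _) ∧ _
  obtain ⟨hI, hIc⟩ := inverseCentralSum_mem_and_cast hpn (by omega)
  obtain ⟨hT, hTc⟩ := tail_sum_mem_and_cast hpn (by omega)
  have h8 := eight_mul_sum_odd_cube hpn hn
  rw [← hIc, harmonicSum_three_eq_bernoulli hpn hn] at h8
  refine ⟨⟨?_, ?_⟩, ?_⟩
  · rw [tail_sum_eq hpn (by omega)]
    refine ratModEq_one_of_zmodCast_eq hT (neg_mem hI) ?_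
    rw [hTc, Rat.cast_neg, ← hIc]
  · have hB : ReducesTo (bernoulli (p - 3)) (bernoulli (p - 3) : ZMod p) :=
      ⟨bernoulli_mem (by omega), rfl⟩
    have h74 := ((ReducesTo.ofNat 7).div (ReducesTo.ofNat 4) h4).mul hB
    rw [neg_mul]
    refine ratModEq_one_of_zmodCast_eq (neg_mem hI) (neg_mem h74.1) ?_
    rw [Rat.cast_neg, Rat.cast_neg, h74.2, neg_inj]
    -- Clears the factor 8 of `eight_mul_sum_odd_cube`: 8·(7/4) = 14 = (-7)(-2).
    refine mul_left_cancel₀ (mul_ne_zero h2 h4) ?_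
    have e7 : (2 * 4 : ZMod p) * (OfNat.ofNat 7 / OfNat.ofNat 4 * (bernoulli (p - 3) : ZMod p)) =
        14 * (bernoulli (p - 3) : ZMod p) := by
      field_simp
      norm_num
      ring
    rw [e7]
    linear_combination h8
  · have e : ∑ k ∈ range n, (Nat.choose (2 * k) k : ℚ) ^ 2 / ((2 * (k : ℚ) + 1) * 16 ^ k) =
        ∑ k ∈ range n, centralTerm ℚ k / (2 * k + 1) := by
      refine sum_congr rfl fun k _ => ?_
      rw [← centralTerm_mul_pow (N := k + 1) (fun j hj _ => by positivity) two_ne_zero k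
        k.lt_succ_self]
      field_simp
    rw [e]
    exact sum_centralTerm_ratModEq hpn hn
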